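/- Let $S$ be a regular local ring with $\operatorname{char}(\operatorname{Frac}S)=0$, let $p$ be a prime number, suppose that $S$ contains a primitive $p$-th root of unity, and let $0\neq f\in S$. Definitions. For an ideal $I$ of a ring $A$ and $g\in A$, let $\Gamma_I(g)\in\mathbb{Z}_{\ge 0}\cup\{\infty\}$ be the supremum of all $m\ge 0$ such that the class of $g$ in $A/I^m$ is a $p$-th power. For a prime $Q$ of $S$ and $x\in S$ let $\operatorname{ord}_Q(x)$ be the supremum of all $m$ with $x\in Q^mS_Q$. The element $f$ is *$p$-unramified* if for some root $\omega$ of $X^p-f$ in an algebraic closure of $\operatorname{Frac}S$, with $R$ the normalization of $S[\omega]$, the map $S_P\to R_P$ is étale for every height one prime $P$ of $S$ containing $p$. It is *tamely $p$-ramified* if for some such $\omega$ and every height one prime $Q$ of $R$ containing $p$ the extension of discrete valuation rings $S_{Q\cap S}\to R_Q$ is tamely ramified: its residue field extension is separable, and the order in $R_Q$ of a uniformizer of $S_{Q\cap S}$ is coprime to the residue characteristic of $S_{Q\cap S}$. Consider the conditions: 1. $f$ is $p$-unramified; 2. $f$ is tamely $p$-ramified; 3. either $f$ is a $p$-th power in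 $S$, or $f\notin\bigcup_{Q\in\operatorname{Ass}(S/(p))}Q$ and $\Gamma_{QS_Q}(f)\ge\frac{p}{p-1}\operatorname{ord}_Q(p)$ for all $Q\in\operatorname{Ass}(S/(p))$; 4. for every $Q\in\operatorname{Ass}(S/(p))$ there are $h,g\in S_Q$ with $f=h^pg$, $g$ a unit of $S_Q$, and $\Gamma_{QS_Q}(g)\ge\frac{p}{p-1}\operatorname{ord}_Q(p)$. Then (1), (2) and (4) are equivalent, and (3) implies (1). If moreover $\operatorname{ord}_Q(f)\le p-1$ for all $Q\in\operatorname{Ass}(S/(p))$, then (1), (2) and (3) are equivalent. -/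

import Mathlib

open scoped ENNReal

noncomputable section

/-- The `I`-adic order of `x`: the supremum of all `m` with `x ∈ I ^ m`. For the maximal ideal of a
discrete valuation ring this is the usual valuation. -/
def idealOrd {A : Type*} [CommRing A] (I : Ideal A) (x : A) : ℕ∞ :=
  ⨆ (m : ℕ) (_ : x ∈ I ^ m), (m : ℕ∞)

/-- The invariant `Γ_I(f, n)`: the supremum of all `m ≥ 0` such that the class of `f` in
`A ⧸ I ^ m` is an `n`-th power. -/
def powerOrd {A : Type*} [CommRing A] (I : Ideal A) (f : A) (n : ℕ) : ℕ∞ :=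
  ⨆ (m : ℕ) (_ : ∃ y : A ⧸ I ^ m, y ^ n = Ideal.Quotient.mk (I ^ m) f), (m : ℕ∞)

/-- `ord_Q(x)` for a prime `Q`: the order of `x` with respect to the maximal ideal of `A_Q`. -/
def primeOrd {A : Type*} [CommRing A] (Q : Ideal A) [Q.IsPrime] (x : A) : ℕ∞ :=
  idealOrd (IsLocalRing.maximalIdeal (Localization.AtPrime Q))
    (algebraMap A (Localization.AtPrime Q) x)

/-- A local extension of discrete valuation rings `V₁ → V₂` is tamely ramified if the extension of
residue fields is separable and the order in `V₂` of a uniformizer of `V₁` is coprime to the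
characteristic of the residue field of `V₁`. -/
def IsTamelyRamified {V₁ V₂ : Type*} [CommRing V₁] [IsLocalRing V₁] [CommRing V₂] [IsLocalRing V₂]
    (φ : V₁ →+* V₂) [IsLocalHom φ] : Prop :=
  (letI := (IsLocalRing.ResidueField.map φ).toAlgebra;
    Algebra.IsSeparable (IsLocalRing.ResidueField V₁) (IsLocalRing.ResidueField V₂)) ∧
  ∃ π : V₁, Irreducible π ∧
    ∃ e : ℕ, idealOrd (IsLocalRing.maximalIdeal V₂) (φ π) = (e : ℕ∞) ∧
      e.Coprime (ringChar (IsLocalRing.ResidueField V₁))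

/-- `S → R` is `p`-unramified: `S_P → R_P` is étale for all height one primes `P` of `S`
containing `p`, where `R_P` is the localization of `R` at the image of `S \ P`. -/
def IsPUnramified (p : ℕ) (S R : Type*) [CommRing S] [CommRing R] [Algebra S R] : Prop :=
  ∀ (P : Ideal S) [P.IsPrime], P.height = 1 → (p : S) ∈ P →
    Algebra.Etale (Localization.AtPrime P)
      (Localization (Algebra.algebraMapSubmonoid R P.primeCompl))

/-- `S → R` (a module finite map of normal domains) is tamely `p`-ramified: `S_{Q ∩ S} → R_Q` is
tamely ramified for all height one primes `Q` of `R` containing `p`. -/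
def IsTamelyPRamified (p : ℕ) (S R : Type*) [CommRing S] [CommRing R] [Algebra S R] : Prop :=
  ∀ (Q : Ideal R) [Q.IsPrime], Q.height = 1 → (p : R) ∈ Q →
    IsTamelyRamified
      (Localization.localRingHom (Q.comap (algebraMap S R)) Q (algebraMap S R) rfl)

/-- The normalization of `S[ω]`, i.e. the integral closure of the domain `S[ω]` in its field of
fractions, for an element `ω` of a field extension of `Frac S`. -/
abbrev RootNormalization (S : Type*) [CommRing S] [IsDomain S]
    (ω : AlgebraicClosure (FractionRing S)) : Type _ :=
  integralClosure (Algebra.adjoin S {ω}) (FractionRing (Algebra.adjoin S {ω}))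

/-- `f` is `p`-unramified: `S → normalization of S[ω]` is so for some root `ω` of `X ^ p - f`. -/
def IsPUnramifiedElement (p : ℕ) {S : Type*} [CommRing S] [IsDomain S] (f : S) : Prop :=
  ∃ ω : AlgebraicClosure (FractionRing S), ω ^ p = algebraMap S _ f ∧
    IsPUnramified p S (RootNormalization S ω)

/-- `f` is tamely `p`-ramified: `S → normalization of S[ω]` is so for some root `ω` of
`X ^ p - f`. -/
def IsTamelyPRamifiedElement (p : ℕ) {S : Type*} [CommRing S] [IsDomain S] (f : S) : Prop :=
  ∃ ω : AlgebraicClosure (FractionRing S), ω ^ p = algebraMap S _ f ∧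
    IsTamelyPRamified p S (RootNormalization S ω)

/-- `Γ_{Q S_Q}(g) ≥ (p / (p - 1)) * ord_Q(p)` for a prime `Q` of `S` and an element `g` of `S_Q`. -/
def PowerOrdBound (p : ℕ) {S : Type*} [CommRing S] (Q : Ideal S) [Q.IsPrime]
    (g : Localization.AtPrime Q) : Prop :=
  ((p : ℝ≥0∞) / ((p : ℝ≥0∞) - 1)) * ((primeOrd Q (p : S) : ℕ∞) : ℝ≥0∞) ≤
    ((powerOrd (IsLocalRing.maximalIdeal (Localization.AtPrime Q)) g p : ℕ∞) : ℝ≥0∞)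

/-- Either `f` is a `p`-th power, or `f` lies in no associated prime `Q` of `S ⧸ (p)` and
`Γ_{Q S_Q}(f) ≥ (p / (p - 1)) * ord_Q(p)` for every such `Q`. -/
def PowerOrdCriterion (p : ℕ) {S : Type*} [CommRing S] (f : S) : Prop :=
  (∃ h : S, h ^ p = f) ∨
  ((∀ Q ∈ associatedPrimes S (S ⧸ Ideal.span {(p : S)}), f ∉ Q) ∧
    ∀ (Q : Ideal S) [Q.IsPrime], Q ∈ associatedPrimes S (S ⧸ Ideal.span {(p : S)}) →
      PowerOrdBound p Q (algebraMap S (Localization.AtPrime Q) f))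

/-- The criterion up to `p`-th powers: for every associated prime `Q` of `S ⧸ (p)` one can write
`f = h ^ p * g` in `S_Q` with `g` a unit and `Γ_{Q S_Q}(g) ≥ (p / (p - 1)) * ord_Q(p)`. -/
def ReducedPowerOrdCriterion (p : ℕ) {S : Type*} [CommRing S] (f : S) : Prop :=
  ∀ (Q : Ideal S) [Q.IsPrime], Q ∈ associatedPrimes S (S ⧸ Ideal.span {(p : S)}) →
    ∃ h g : Localization.AtPrime Q, algebraMap S (Localization.AtPrime Q) f = h ^ p * g ∧
      IsUnit g ∧ PowerOrdBound p Q g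

end

/-!
Let `l = ε - 1`. Since `p` is associated to `l ^ (p - 1)`, the number `p / (p - 1) * ord_Q(p)` is
the order of `l ^ p`, so that the bound on `Γ` says that `g` is congruent to a `p`-th power modulo
`l ^ p` (`powerOrdBound_iff`). The primes associated to `S ⧸ (p)` are the primes of height one
containing `p`, and the localizations at them are discrete valuation rings, because `S` is a normal
Noetherian domain (`mem_associatedPrimes_iff_height_eq_one`). Everything thus takes place over
discrete valuation rings of residue characteristic `p` in which Kummer theory applies. That regular
local rings are normal domains is proved by induction on the dimension
(`IsRegularLocalRing.isDomain_and_isIntegrallyClosed`).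

If `f = h ^ p * g` with `g` a unit congruent to `y ^ p` modulo `l ^ p`, put `η = ω / h` and
`θ = (η - y) / l`. The equation `η ^ p = g` becomes a monic equation `F(θ) = 0`, and `F'(θ)` is a
unit multiple of `η ^ (p - 1)`, hence a unit. So `θ` generates the normalization, which is étale
(`ReducedPowerOrdCriterion.isPUnramified`).

Étale extensions of discrete valuation rings are tamely ramified, with ramification index one
(`IsPUnramified.isTamelyPRamified`).

In a tamely ramified extension the order of `f` is divisible by `p`, and a unit `u = η ^ p` which is
not congruent to a `p`-th power modulo `l ^ p` would have no best approximation by a `p`-th power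
`y ^ p`: the factors of `η ^ p - y ^ p = ∏ (η - ζ y)` have equal orders, and separability of the
residue field extension allows the leading coefficient of `η - y` to be taken from the base, which
improves `y` (`IsTamelyRamified.exists_eq_pow_mul`).

If `ord_Q(f) < p`, then `h` is a unit and the criterion for `g` is one for `f`.
-/

/-! ### Regular local rings are normal domains -/

/-- A fraction `a / b` whose powers have the common denominator `d` is almost integral, hence lies
in a normal Noetherian domain. -/
lemma IsIntegrallyClosed.dvd_of_forall_pow_dvd_mul_pow {A : Type*} [CommRing A] [IsDomain A]
    [IsNoetherianRing A] [IsIntegrallyClosed A] {a b d : A} (hb : b ≠ 0) (hd : d ≠ 0)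
    (h : ∀ n, b ^ n ∣ d * a ^ n) : b ∣ a := by
  set K := FractionRing A
  have hb' : algebraMap A K b ≠ 0 := by simpa using hb
  have hint : IsAlmostIntegral A (algebraMap A K a / algebraMap A K b) := by
    refine ⟨d, mem_nonZeroDivisors_of_ne_zero hd, fun n ↦ ?_⟩
    obtain ⟨c, hc⟩ := h n
    refine ⟨c, ?_⟩
    rw [Algebra.smul_def, div_pow, ← map_pow, ← map_pow, ← mul_div_assoc, ← map_mul, hc, map_mul,
      mul_div_cancel_left₀ _ (by simpa using pow_ne_zero n hb)]
  obtain ⟨c, hc⟩ := IsIntegrallyClosed.isIntegral_iff.mp hint.isIntegral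
  refine ⟨c, IsFractionRing.injective A K ?_⟩
  rw [map_mul, hc, mul_div_cancel₀ _ hb']

lemma IsIntegral.exists_pow_dvd_mul_pow {A K : Type*} [CommRing A] [IsDomain A] [Field K]
    [Algebra A K] [IsFractionRing A K] {t : K} (ht : IsIntegral A t) {a b : A}
    (h : t * algebraMap A K b = algebraMap A K a) : ∃ d ≠ 0, ∀ n, b ^ n ∣ d * a ^ n := by
  obtain ⟨d, hd, hdn⟩ := ht.isAlmostIntegral
  refine ⟨d, nonZeroDivisors.ne_zero hd, fun n ↦ ?_⟩
  obtain ⟨c, hc⟩ := hdn n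
  refine ⟨c, IsFractionRing.injective A K ?_⟩
  rw [map_mul, map_mul, map_pow, map_pow, hc, ← h, Algebra.smul_def]
  ring

/-- Principal ideals of a Noetherian local ring are closed in the `x`-adic topology, by the
intersection theorem of Krull for `A ⧸ (b)`. -/
lemma IsLocalRing.dvd_of_forall_exists_pow_dvd_sub {A : Type*} [CommRing A] [IsNoetherianRing A]
    [IsLocalRing A] {x a b : A} (hx : x ∈ maximalIdeal A)
    (h : ∀ k : ℕ, ∃ r, x ^ k ∣ a - b * r) : b ∣ a := by
  have key := Ideal.iInf_pow_smul_eq_bot_of_isLocalRing (R := A) (M := A ⧸ Ideal.span {b})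
    (Ideal.span {x}) (fun h ↦ (maximalIdeal.isMaximal A).ne_top
      (top_le_iff.mp (h ▸ (Ideal.span_singleton_le_iff_mem _).mpr hx)))
  rw [← Ideal.mem_span_singleton, ← Ideal.Quotient.eq_zero_iff_mem, ← Submodule.mem_bot A, ← key,
    Submodule.mem_iInf]
  intro k
  obtain ⟨r, c, hc⟩ := h k
  have : Ideal.Quotient.mk (Ideal.span {b}) a = x ^ k • Ideal.Quotient.mk (Ideal.span {b}) c := by
    rw [← Ideal.Quotient.mk_eq_mk, ← Ideal.Quotient.mk_eq_mk, ← Submodule.Quotient.mk_smul,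
      Submodule.Quotient.eq]
    refine Ideal.mem_span_singleton.mpr ⟨r, ?_⟩
    rw [smul_eq_mul, ← hc]; ring
  rw [this]
  exact Submodule.smul_mem_smul (Ideal.pow_mem_pow (Ideal.mem_span_singleton_self x) k) trivial

/-- Normality lifts from the quotient by a prime element `x`. An integral fraction `a / b` with `b`
prime to `x` is approximated `x`-adically by elements of `A`, one coefficient at a time: the next
coefficient is almost integral over `A ⧸ (x)`. As `b A` is closed, `b` divides `a`. Powers of `x` in
the denominator are removed one by one. -/
theorem IsIntegrallyClosed.of_quotient_span_singleton {A : Type*} [CommRing A] [IsDomain A]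
    [IsNoetherianRing A] [IsLocalRing A] {x : A} (hx : x ∈ IsLocalRing.maximalIdeal A)
    (hx0 : x ≠ 0) [IsDomain (A ⧸ Ideal.span {x})] [IsIntegrallyClosed (A ⧸ Ideal.span {x})] :
    IsIntegrallyClosed A := by
  have hprime : Prime x := (Ideal.span_singleton_prime hx0).mp
    ((Ideal.Quotient.isDomain_iff_prime _).mp inferInstance)
  have hdecomp : ∀ d : A, d ≠ 0 → ∃ n c, d = x ^ n * c ∧ ¬ x ∣ c := fun d hd ↦ by
    have hfin : FiniteMultiplicity x d := FiniteMultiplicity.of_prime_left hprime hd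
    exact ⟨_, hfin.exists_eq_pow_mul_and_not_dvd⟩
  set K := FractionRing A
  refine (isIntegrallyClosed_iff K).mpr fun {t} ht ↦ ?_
  -- fractions with denominator `x`
  have hA : ∀ t : K, IsIntegral A t → ∀ c, t * algebraMap A K x = algebraMap A K c →
      ∃ y, algebraMap A K y = t := by
    intro t ht c hc
    obtain ⟨d, hd, hdn⟩ := ht.exists_pow_dvd_mul_pow hc
    obtain ⟨n, d, rfl, hxd⟩ := hdecomp d hd
    have h1 := hdn (n + 1)
    rw [pow_succ, mul_assoc, mul_dvd_mul_iff_left (pow_ne_zero n hx0)] at h1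
    obtain ⟨y, rfl⟩ := hprime.dvd_of_dvd_pow ((hprime.dvd_or_dvd h1).resolve_left hxd)
    refine ⟨y, ?_⟩
    have : algebraMap A K x ≠ 0 := by simpa using hx0
    refine mul_right_cancel₀ this ?_
    rw [hc, map_mul, mul_comm]
  -- denominators prime to `x`
  have hB : ∀ t : K, IsIntegral A t → ∀ a b, ¬ x ∣ b → t * algebraMap A K b = algebraMap A K a →
      ∃ y, algebraMap A K y = t := by
    intro t ht a b hxb hab
    have hb0 : b ≠ 0 := fun h ↦ hxb (h ▸ dvd_zero x)
    have hdvd : b ∣ a := by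
      refine IsLocalRing.dvd_of_forall_exists_pow_dvd_sub hx fun k ↦ ?_
      induction k with
      | zero => exact ⟨0, by simp⟩
      | succ k ih =>
        obtain ⟨r, a₁, hr⟩ := ih
        have hint : IsIntegral A (t - algebraMap A K r) := ht.sub isIntegral_algebraMap
        obtain ⟨d, hd, hdn⟩ := hint.exists_pow_dvd_mul_pow (a := x ^ k * a₁) (b := b) (by
          rw [← hr, sub_mul, hab, map_sub, map_mul]; ring)
        obtain ⟨δ, d, rfl, hxd⟩ := hdecomp d hd
        have h1 : ∀ n, b ^ n ∣ d * a₁ ^ n := by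
          intro n
          obtain ⟨q, hq⟩ := hdn n
          have h2 : x ^ (δ + k * n) ∣ b ^ n * q := ⟨d * a₁ ^ n, by rw [← hq]; ring⟩
          obtain ⟨q, rfl⟩ := hprime.pow_dvd_of_dvd_mul_left _
            (fun h ↦ hxb (hprime.dvd_of_dvd_pow h)) h2
          refine ⟨q, mul_left_cancel₀ (pow_ne_zero (δ + k * n) hx0) ?_⟩
          calc _ = x ^ δ * d * (x ^ k * a₁) ^ n := by ring
            _ = _ := by rw [hq]; ring
        have hmk : ∀ c, ¬ x ∣ c → Ideal.Quotient.mk (Ideal.span {x}) c ≠ 0 := fun c hc h ↦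
          hc (Ideal.mem_span_singleton.mp (Ideal.Quotient.eq_zero_iff_mem.mp h))
        obtain ⟨s, hs⟩ := IsIntegrallyClosed.dvd_of_forall_pow_dvd_mul_pow
          (a := Ideal.Quotient.mk (Ideal.span {x}) a₁) (hmk b hxb) (hmk d hxd) (fun n ↦ by
            simpa using map_dvd (Ideal.Quotient.mk (Ideal.span {x})) (h1 n))
        obtain ⟨s, rfl⟩ := Ideal.Quotient.mk_surjective s
        rw [← map_mul, Ideal.Quotient.eq, Ideal.mem_span_singleton] at hs
        obtain ⟨a₂, ha₂⟩ := hs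
        refine ⟨r + x ^ k * s, a₂, ?_⟩
        linear_combination hr + x ^ k * ha₂
    obtain ⟨c, rfl⟩ := hdvd
    have : algebraMap A K b ≠ 0 := by simpa using hb0
    exact ⟨c, mul_right_cancel₀ this (by rw [hab, map_mul, mul_comm])⟩
  obtain ⟨a, b, hb, rfl⟩ := IsFractionRing.div_surjective (A := A) t
  have hb0 := nonZeroDivisors.ne_zero hb
  obtain ⟨n, c, rfl, hc⟩ := hdecomp b hb0
  set t := algebraMap A K a / algebraMap A K (x ^ n * c) with ht_def
  have hstep : ∀ k, ∃ y, algebraMap A K y = t * algebraMap A K x ^ (n - k) := by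
    intro k
    induction k with
    | zero =>
      refine hB _ (ht.mul (isIntegral_algebraMap.pow _)) a c hc ?_
      rw [ht_def, mul_assoc, Nat.sub_zero, ← map_pow, ← map_mul, div_mul_cancel₀]
      simpa using hb0
    | succ k ih =>
      by_cases hk : n ≤ k
      · rwa [Nat.sub_eq_zero_of_le (by lia), ← Nat.sub_eq_zero_of_le hk]
      · obtain ⟨y, hy⟩ := ih
        refine hA _ (ht.mul (isIntegral_algebraMap.pow _)) y ?_
        rw [hy, mul_assoc, ← pow_succ]
        congr 2
        lia
  simpa using hstep n

/-- Dividing by an element of order one lowers the embedding dimension: in a minimal system of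
generators of the maximal ideal, one that occurs in `x` with a unit coefficient becomes
superfluous. -/
lemma IsRegularLocalRing.spanFinrank_quotient_le {A : Type*} [CommRing A] [IsNoetherianRing A]
    [IsLocalRing A] {x : A} (hx : x ∈ IsLocalRing.maximalIdeal A)
    (hx2 : x ∉ IsLocalRing.maximalIdeal A ^ 2) [IsLocalRing (A ⧸ Ideal.span {x})] :
    (IsLocalRing.maximalIdeal (A ⧸ Ideal.span {x})).spanFinrank + 1 ≤
      (IsLocalRing.maximalIdeal A).spanFinrank := by
  classical
  obtain ⟨s, hs, hspan⟩ := Submodule.FG.exists_span_finset_card_eq_spanFinrank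
    (IsLocalRing.maximalIdeal A).fg_of_isNoetherianRing
  set mk := Ideal.Quotient.mk (Ideal.span {x})
  have hsm : ∀ i ∈ s, i ∈ IsLocalRing.maximalIdeal A := fun i hi ↦
    hspan ▸ Submodule.subset_span hi
  have hx' := hx
  rw [← hspan, Submodule.mem_span_finset] at hx'
  obtain ⟨c, -, hc⟩ := hx'
  obtain ⟨j, hj, hju⟩ : ∃ j ∈ s, c j ∉ IsLocalRing.maximalIdeal A := by
    by_contra! hcon
    refine hx2 ?_
    rw [← hc, pow_two]
    exact Submodule.sum_mem _ fun i hi ↦ Ideal.mul_mem_mul (hcon i hi) (hsm i hi)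
  have hju' : IsUnit (c j) := by simpa using hju
  have hmax : IsLocalRing.maximalIdeal (A ⧸ Ideal.span {x}) =
      Ideal.span (mk '' (s.erase j : Finset A)) := by
    have h1 : (IsLocalRing.maximalIdeal A).map mk =
        IsLocalRing.maximalIdeal (A ⧸ Ideal.span {x}) := by
      have := Ideal.map_eq_top_or_isMaximal_of_surjective mk Ideal.Quotient.mk_surjective
        (IsLocalRing.maximalIdeal.isMaximal A)
      refine IsLocalRing.eq_maximalIdeal (this.resolve_left fun htop ↦ ?_)
      have h1 := (Ideal.eq_top_iff_one _).mp htop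
      obtain ⟨y, hy, hy1⟩ := (Ideal.mem_map_iff_of_surjective mk Ideal.Quotient.mk_surjective).mp h1
      rw [← map_one mk, Ideal.Quotient.eq] at hy1
      exact (Ideal.ne_top_iff_one _).mp (IsLocalRing.maximalIdeal.isMaximal A).ne_top
        (by simpa using sub_mem hy ((Ideal.span_singleton_le_iff_mem _).mpr hx hy1))
    rw [← h1]
    conv_lhs => rw [← hspan]
    change Ideal.map mk (Ideal.span _) = _
    rw [Ideal.map_span]
    refine le_antisymm (Ideal.span_le.mpr ?_) (Ideal.span_mono (Set.image_mono (by simp)))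
    rintro _ ⟨i, hi, rfl⟩
    by_cases hij : i = j
    · subst hij
      have h0 : mk (c i) * mk i = - ∑ k ∈ s.erase i, mk (c k) * mk k := by
        rw [eq_neg_iff_add_eq_zero, Finset.add_sum_erase _ (fun k ↦ mk (c k) * mk k) hj]
        have : mk x = 0 := Ideal.Quotient.eq_zero_iff_mem.mpr (Ideal.mem_span_singleton_self x)
        refine Eq.trans ?_ this
        simpa using congrArg mk hc
      refine (Ideal.unit_mul_mem_iff_mem _ (hju'.map mk)).mp ?_
      rw [h0]
      exact neg_mem (Submodule.sum_mem _ fun k hk ↦ Ideal.mul_mem_left _ _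
        (Ideal.subset_span ⟨k, hk, rfl⟩))
    · exact Ideal.subset_span ⟨i, by simpa using ⟨hi, hij⟩, rfl⟩
  have hfin : (mk '' ((s.erase j : Finset A) : Set A)).Finite := (Finset.finite_toSet _).image _
  have h2 := Submodule.spanFinrank_span_le_ncard_of_finite
    (R := A ⧸ Ideal.span {x}) hfin
  have h3 := Set.ncard_image_le (f := mk) (Finset.finite_toSet (s.erase j))
  rw [Set.ncard_coe_finset] at h3
  have h4 := Finset.card_erase_add_one hj
  rw [hmax]
  rw [← hs]
  change (Submodule.span _ _).spanFinrank + 1 ≤ _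
  lia

/-- Regular local rings are normal domains: by induction on the dimension, both properties lift
from the quotient by a suitable element of order one. -/
theorem IsRegularLocalRing.isDomain_and_isIntegrallyClosed (A : Type*) [CommRing A]
    [IsRegularLocalRing A] : IsDomain A ∧ IsIntegrallyClosed A := by
  obtain ⟨n, hn⟩ : ∃ n, (IsLocalRing.maximalIdeal A).spanFinrank = n := ⟨_, rfl⟩
  induction n generalizing A with
  | zero =>
    have : IsLocalRing.maximalIdeal A = ⊥ := (Submodule.spanFinrank_eq_zero_iff_eq_bot
      (IsLocalRing.maximalIdeal A).fg_of_isNoetherianRing).mp hn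
    have hf : IsField A := IsLocalRing.isField_iff_maximalIdeal_eq.mpr this
    let := hf.toField
    exact ⟨inferInstance, inferInstance⟩
  | succ n ih =>
    have hdim : ringKrullDim A = (n + 1 : ℕ) := by
      rw [← hn, IsRegularLocalRing.spanFinrank_maximalIdeal]
    set m := IsLocalRing.maximalIdeal A
    have hm0 : m ≠ ⊥ := fun h ↦ by
      rw [h, Submodule.spanFinrank_bot] at hn; lia
    have hm2 : ¬ m ≤ m ^ 2 := fun h ↦ hm0 <|
      Submodule.eq_bot_of_le_smul_of_le_jacobson_bot m m m.fg_of_isNoetherianRing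
        (by rwa [smul_eq_mul, ← pow_two]) (IsLocalRing.maximalIdeal_le_jacobson _)
    -- prime avoidance, where the ideal `m ^ 2` need not be prime; avoiding the minimal primes is
    -- what makes `x` prime once the quotient is known to be a domain
    obtain ⟨x, hx, hx2, hxmin⟩ : ∃ x ∈ m, x ∉ m ^ 2 ∧ ∀ q ∈ minimalPrimes A, x ∉ q := by
      by_contra! hcon
      have hsub : (m : Set A) ⊆ ⋃ i ∈ insert (m ^ 2) (minimalPrimes A), (id i : Ideal A) := by
        intro x hx
        by_cases hx2 : x ∈ m ^ 2
        · exact Set.mem_biUnion (Set.mem_insert _ _) hx2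
        · obtain ⟨q, hq, hxq⟩ := hcon x hx hx2
          exact Set.mem_biUnion (Set.mem_insert_of_mem _ hq) hxq
      obtain ⟨q, hq, hle⟩ := (Ideal.subset_union_prime_finite
        ((minimalPrimes.finite_of_isNoetherianRing A).insert _) (m ^ 2) (m ^ 2)
        (by
          rintro i (rfl | hi) h _
          · exact absurd rfl h
          · exact hi.1.1)).mp hsub
      rcases hq with rfl | hq
      · exact hm2 hle
      · have hqp : q.IsPrime := hq.1.1
        have hqm : q = m := le_antisymm (IsLocalRing.le_maximalIdeal hqp.ne_top) hle
        have h0 : m.height = 0 := by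
          have : m.IsPrime := inferInstance
          exact Ideal.height_eq_zero_iff.mpr (hqm ▸ hq)
        have := IsLocalRing.maximalIdeal_height_eq_ringKrullDim (R := A)
        rw [h0, hdim] at this
        norm_cast at this
    set I : Ideal A := Ideal.span {x}
    have hIm : I ≤ m := (Ideal.span_singleton_le_iff_mem _).mpr hx
    have : Nontrivial (A ⧸ I) := Ideal.Quotient.nontrivial_iff.mpr
      (ne_top_of_le_ne_top (IsLocalRing.maximalIdeal.isMaximal A).ne_top hIm)
    have : IsLocalRing (A ⧸ I) := .of_surjective' _ Ideal.Quotient.mk_surjective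
    have hle : (IsLocalRing.maximalIdeal (A ⧸ I)).spanFinrank + 1 ≤ n + 1 :=
      (IsRegularLocalRing.spanFinrank_quotient_le hx hx2).trans hn.le
    have hdim2 : ringKrullDim A ≤ ringKrullDim (A ⧸ I) + 1 := by
      have h1 := ringKrullDim_le_ringKrullDim_quotient_add_card ({x} : Finset A)
        (by
          rw [IsLocalRing.ringJacobson_eq_maximalIdeal, Finset.coe_singleton]
          exact Set.singleton_subset_iff.mpr hx)
      rwa [Finset.card_singleton, Nat.cast_one, Finset.coe_singleton] at h1
    have hge : ((n : ℕ) : WithBot ℕ∞) ≤ ringKrullDim (A ⧸ I) := by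
      rw [hdim, Nat.cast_add, Nat.cast_one] at hdim2
      exact (WithBot.add_le_add_iff_right' (c := 1) WithBot.one_ne_bot
        (fun h ↦ ENat.one_ne_top (WithBot.coe_injective h))).mp hdim2
    have hreg : IsRegularLocalRing (A ⧸ I) := by
      refine IsRegularLocalRing.of_spanFinrank_maximalIdeal_le _ (le_trans ?_ hge)
      exact_mod_cast (by lia : (IsLocalRing.maximalIdeal (A ⧸ I)).spanFinrank ≤ n)
    have hrk : (IsLocalRing.maximalIdeal (A ⧸ I)).spanFinrank = n := by
      refine le_antisymm (by lia) ?_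
      rw [← IsRegularLocalRing.spanFinrank_maximalIdeal] at hge
      exact_mod_cast hge
    obtain ⟨hdom, hcl⟩ := ih (A ⧸ I) hrk
    have hIp : I.IsPrime := (Ideal.Quotient.isDomain_iff_prime _).mp hdom
    have hA : IsDomain A := by
      obtain ⟨q, hq, hqI⟩ := Ideal.exists_minimalPrimes_le (I := ⊥) (J := I) bot_le
      have hqp : q.IsPrime := hq.1.1
      have hxq : x ∉ q := hxmin q hq
      -- a minimal prime `q` below `(x)` satisfies `q = x q`
      have hq0 : q = ⊥ := by
        refine Submodule.eq_bot_of_le_smul_of_le_jacobson_bot I q q.fg_of_isNoetherianRing ?_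
          (hIm.trans (IsLocalRing.maximalIdeal_le_jacobson _))
        intro y hy
        obtain ⟨r, rfl⟩ := Ideal.mem_span_singleton.mp (hqI hy)
        exact Submodule.smul_mem_smul (Ideal.mem_span_singleton_self x)
          ((hqp.mem_or_mem hy).resolve_left hxq)
      rw [hq0] at hqp
      exact IsDomain.of_bot_isPrime A
    have hx0 : x ≠ 0 := fun h ↦ hx2 (h ▸ zero_mem _)
    exact ⟨hA, IsIntegrallyClosed.of_quotient_span_singleton hx hx0⟩

/-! ### Height one primes of normal Noetherian domains -/

/-- The localization of a normal Noetherian domain at a prime associated to a principal ideal `(x)`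
is a discrete valuation ring. If `Q = ((x) : a)`, then `a / x` maps the maximal ideal of the
localization onto the whole ring, and the maximal ideal is therefore principal; otherwise `a / x`
would map the maximal ideal into itself and be integral. -/
theorem IsDiscreteValuationRing.localization_of_mem_associatedPrimes {A : Type*} [CommRing A]
    [IsDomain A] [IsNoetherianRing A] [IsIntegrallyClosed A] {x : A} (hx : x ≠ 0) (Q : Ideal A)
    [Q.IsPrime] (hQ : Q ∈ associatedPrimes A (A ⧸ Ideal.span {x})) :
    IsDiscreteValuationRing (Localization.AtPrime Q) := by
  let V := Localization.AtPrime Q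
  have hle := Q.primeCompl_le_nonZeroDivisors
  have : IsIntegrallyClosed V := isIntegrallyClosed_of_isLocalization V Q.primeCompl hle
  have hinj : Function.Injective (algebraMap A V) := IsLocalization.injective V hle
  rw [AssociatedPrimes.mem_iff, isAssociatedPrime_iff] at hQ
  obtain ⟨-, a, ha⟩ := hQ
  obtain ⟨a, rfl⟩ := Ideal.Quotient.mk_surjective a
  have hmem : ∀ r, r ∈ Q ↔ x ∣ r * a := fun r ↦ by
    rw [ha, Submodule.mem_colon_singleton, Submodule.mem_bot, ← Ideal.Quotient.mk_eq_mk,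
      ← Submodule.Quotient.mk_smul, Ideal.Quotient.mk_eq_mk, Ideal.Quotient.eq_zero_iff_mem,
      Ideal.mem_span_singleton, smul_eq_mul]
  have hxQ : x ∈ Q := (hmem x).mpr (dvd_mul_right x a)
  have hxV : algebraMap A V x ≠ 0 := (map_ne_zero_iff _ hinj).mpr hx
  have hxm : algebraMap A V x ∈ IsLocalRing.maximalIdeal V :=
    (IsLocalization.AtPrime.to_map_mem_maximal_iff V Q x).mpr hxQ
  have hndvd : ¬ algebraMap A V x ∣ algebraMap A V a := by
    rintro ⟨c, hc⟩
    obtain ⟨⟨c, s⟩, hs⟩ := IsLocalization.surj Q.primeCompl c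
    refine s.2 ((hmem s).mpr ⟨c, hinj ?_⟩)
    simp only at hs
    rw [map_mul, map_mul, hc, ← hs]
    ring
  have hdvd : ∀ r ∈ IsLocalRing.maximalIdeal V, algebraMap A V x ∣ r * algebraMap A V a := by
    intro r hr
    have : (IsLocalRing.maximalIdeal V) ≤
        (Ideal.span {algebraMap A V x}).colon {algebraMap A V a} := by
      rw [← Localization.AtPrime.map_eq_maximalIdeal, Ideal.map_le_iff_le_comap]
      intro r hr
      rw [Ideal.mem_comap, Submodule.mem_colon_singleton, smul_eq_mul, ← map_mul,
        Ideal.mem_span_singleton]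
      exact map_dvd _ ((hmem r).mp hr)
    have := this hr
    rwa [Submodule.mem_colon_singleton, smul_eq_mul, Ideal.mem_span_singleton] at this
  obtain ⟨r₀, hr₀, u, hu, hr₀u⟩ : ∃ r₀ ∈ IsLocalRing.maximalIdeal V, ∃ u, IsUnit u ∧
      r₀ * algebraMap A V a = algebraMap A V x * u := by
    by_contra! hcon
    refine hndvd (IsIntegrallyClosed.dvd_of_forall_pow_dvd_mul_pow hxV hxV fun n ↦ ?_)
    have : ∃ r ∈ IsLocalRing.maximalIdeal V,
        algebraMap A V x * algebraMap A V a ^ n = algebraMap A V x ^ n * r := by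
      induction n with
      | zero => exact ⟨_, hxm, by ring⟩
      | succ n ih =>
        obtain ⟨r, hr, hrn⟩ := ih
        obtain ⟨r', hr'⟩ := hdvd r hr
        refine ⟨r', fun h ↦ hcon r hr r' h hr', ?_⟩
        rw [pow_succ, ← mul_assoc, hrn, mul_assoc, hr']
        ring
    obtain ⟨r, -, hr⟩ := this
    exact ⟨r, hr⟩
  have hprinc : (IsLocalRing.maximalIdeal V).IsPrincipal := by
    refine ⟨r₀, le_antisymm (fun r hr ↦ ?_) ((Ideal.span_singleton_le_iff_mem _).mpr hr₀)⟩
    obtain ⟨c, hc⟩ := hdvd r hr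
    obtain ⟨v, rfl⟩ := hu
    refine Ideal.mem_span_singleton.mpr ⟨c * ↑v⁻¹, mul_left_cancel₀ hxV ?_⟩
    have hv : (v : V) * ↑v⁻¹ = 1 := v.mul_inv
    linear_combination (-algebraMap A V x * r) * hv - r * ↑v⁻¹ * hr₀u + r₀ * ↑v⁻¹ * hc
  have hfield : ¬ IsField V := fun h ↦ by
    rw [IsLocalRing.isField_iff_maximalIdeal_eq] at h
    rw [h, Submodule.mem_bot] at hxm
    exact hxV hxm
  exact ((IsDiscreteValuationRing.TFAE V hfield).out 0 4).mpr hprinc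

lemma mem_associatedPrimes_of_height_eq_one {A : Type*} [CommRing A]
    [IsDomain A] [IsNoetherianRing A] {x : A} (hx : x ≠ 0) (Q : Ideal A)
    [Q.IsPrime] (hQ : Q.height = 1) (hxQ : x ∈ Q) :
    Q ∈ associatedPrimes A (A ⧸ Ideal.span {x}) := by
  refine Module.associatedPrimes.minimalPrimes_annihilator_subset_associatedPrimes A _ ?_
  rw [Ideal.annihilator_quotient]
  have : Q.FiniteHeight := inferInstance
  refine Ideal.mem_minimalPrimes_of_height_le ((Ideal.span_singleton_le_iff_mem _).mpr hxQ) ?_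
  rw [hQ, Order.one_le_iff_pos, pos_iff_ne_zero, Ne, Ideal.height_eq_zero_iff_eq_bot]
  simpa using hx

lemma mem_associatedPrimes_iff_height_eq_one {A : Type*} [CommRing A]
    [IsDomain A] [IsNoetherianRing A] [IsIntegrallyClosed A] {x : A} (hx : x ≠ 0) (Q : Ideal A)
    [Q.IsPrime] :
    Q ∈ associatedPrimes A (A ⧸ Ideal.span {x}) ↔ Q.height = 1 ∧ x ∈ Q := by
  refine ⟨fun h ↦ ⟨?_, ?_⟩, fun h ↦ mem_associatedPrimes_of_height_eq_one hx Q h.1 h.2⟩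
  · have := IsDiscreteValuationRing.localization_of_mem_associatedPrimes hx Q h
    have h1 := IsLocalization.AtPrime.ringKrullDim_eq_height Q (Localization.AtPrime Q)
    rw [IsDiscreteValuationRing.ringKrullDim_eq_one] at h1
    exact_mod_cast h1.symm
  · have h1 := IsAssociatedPrime.annihilator_le (AssociatedPrimes.mem_iff.mp h)
    rw [Submodule.annihilator_top, Ideal.annihilator_quotient] at h1
    exact h1 (Ideal.mem_span_singleton_self x)

lemma IsDiscreteValuationRing.localization_of_height_eq_one {A : Type*} [CommRing A]
    [IsDomain A] [IsNoetherianRing A] [IsIntegrallyClosed A] (Q : Ideal A) [Q.IsPrime]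
    (hQ : Q.height = 1) : IsDiscreteValuationRing (Localization.AtPrime Q) := by
  obtain ⟨x, hxQ, hx⟩ := Submodule.exists_mem_ne_zero_of_ne_bot (Ideal.ne_bot_of_height_eq_one hQ)
  exact .localization_of_mem_associatedPrimes hx Q
    (mem_associatedPrimes_of_height_eq_one hx Q hQ hxQ)

section Heights

variable {S R : Type*} [CommRing S] [IsDomain S] [CommRing R] [IsDomain R] [Algebra S R]
  [FaithfulSMul S R] [Algebra.IsIntegral S R]

/-- Going down, over a normal base, and incomparability. -/
lemma Ideal.height_comap_eq_one [IsNoetherianRing S] [IsIntegrallyClosed S] [IsNoetherianRing R]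
    {Q : Ideal R} [Q.IsPrime] (hQ : Q.height = 1) :
    (Q.comap (algebraMap S R)).height = 1 := by
  have : Q.LiesOver (Q.comap (algebraMap S R)) := ⟨rfl⟩
  have h1 := Ideal.height_eq_height_add_of_liesOver_of_hasGoingDown (Q.comap (algebraMap S R)) Q
  rw [hQ] at h1
  refine le_antisymm (h1 ▸ le_self_add) ?_
  rw [Order.one_le_iff_pos, pos_iff_ne_zero, Ne, Ideal.height_eq_zero_iff_eq_bot]
  exact fun h ↦ Ideal.ne_bot_of_height_eq_one hQ (Ideal.eq_bot_of_comap_eq_bot h)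

lemma Ideal.height_eq_one_of_comap {Q : Ideal R} [Q.IsPrime]
    (hQ : (Q.comap (algebraMap S R)).height = 1) : Q.height = 1 := by
  refine le_antisymm ?_ ?_
  · rw [← Nat.cast_one, Ideal.height_le_iff]
    intro q hq hqQ
    obtain ⟨hle, x, hx, hxq⟩ := SetLike.lt_iff_le_and_exists.mp hqQ
    have h1 := Ideal.comap_lt_comap_of_integral_mem_sdiff (R := S) hle ⟨hx, hxq⟩
      (Algebra.IsIntegral.isIntegral x)
    have h2 := Ideal.height_le_iff.mp (le_of_eq (hQ.trans Nat.cast_one.symm)) _ inferInstance h1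
    rw [Nat.cast_one, Order.lt_one_iff, Ideal.height_eq_zero_iff_eq_bot] at h2
    rw [Nat.cast_one, Order.lt_one_iff, Ideal.height_eq_zero_iff_eq_bot]
    exact Ideal.eq_bot_of_comap_eq_bot h2
  · rw [Order.one_le_iff_pos, pos_iff_ne_zero, Ne, Ideal.height_eq_zero_iff_eq_bot]
    rintro rfl
    refine Ideal.ne_bot_of_height_eq_one hQ ?_
    exact Ideal.comap_bot_of_injective _ (FaithfulSMul.algebraMap_injective S R)

end Heights

/-! ### Orders and roots of unity -/

section

open Polynomial

/-- A supremum over a downward closed set of natural numbers containing `0` bounds exactly the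
elements of that set. -/
lemma ENat.natCast_le_iSup_iff {P : ℕ → Prop} (h0 : P 0) (hP : ∀ m n, m ≤ n → P n → P m) (N : ℕ) :
    (N : ℕ∞) ≤ ⨆ (m : ℕ) (_ : P m), (m : ℕ∞) ↔ P N := by
  refine ⟨fun h ↦ ?_, fun h ↦ le_iSup₂_of_le N h le_rfl⟩
  obtain _ | N := N
  · exact h0
  · by_contra hN
    have : ⨆ (m : ℕ) (_ : P m), (m : ℕ∞) ≤ N := by
      refine iSup₂_le fun m hm ↦ ?_
      have : m ≤ N := by
        by_contra! hlt
        exact hN (hP _ _ hlt hm)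
      exact_mod_cast this
    have h1 := h.trans this
    norm_cast at h1
    lia

lemma natCast_le_idealOrd_iff {A : Type*} [CommRing A] (I : Ideal A) (x : A) (N : ℕ) :
    (N : ℕ∞) ≤ idealOrd I x ↔ x ∈ I ^ N :=
  ENat.natCast_le_iSup_iff (P := fun m ↦ x ∈ I ^ m) (by simp)
    (fun _ _ h h' ↦ Ideal.pow_le_pow_right h h') N

lemma natCast_le_powerOrd_iff {A : Type*} [CommRing A] (I : Ideal A) (g : A) (n N : ℕ) :
    (N : ℕ∞) ≤ powerOrd I g n ↔ ∃ y, g - y ^ n ∈ I ^ N := by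
  have key : ∀ m, (∃ y : A ⧸ I ^ m, y ^ n = Ideal.Quotient.mk (I ^ m) g) ↔
      ∃ y, g - y ^ n ∈ I ^ m := fun m ↦ by
    rw [Ideal.Quotient.mk_surjective.exists]
    simp_rw [← map_pow, eq_comm (b := Ideal.Quotient.mk (I ^ m) g), Ideal.Quotient.eq]
  simp_rw [powerOrd, key]
  exact ENat.natCast_le_iSup_iff (P := fun m ↦ ∃ y, g - y ^ n ∈ I ^ m) (by simp)
    (fun _ _ h ⟨y, h'⟩ ↦ ⟨y, Ideal.pow_le_pow_right h h'⟩) N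

open IsDiscreteValuationRing in
lemma idealOrd_maximalIdeal_eq_addVal {V : Type*} [CommRing V] [IsDomain V]
    [IsDiscreteValuationRing V] (x : V) :
    idealOrd (IsLocalRing.maximalIdeal V) x = addVal V x := by
  obtain ⟨π, hπ⟩ := exists_irreducible V
  refine ENat.eq_of_forall_natCast_le_iff fun N ↦ ?_
  rw [natCast_le_idealOrd_iff, hπ.maximalIdeal_eq, Ideal.span_singleton_pow,
    Ideal.mem_span_singleton, ← addVal_le_iff_dvd, hπ.addVal_pow]

lemma IsPrimitiveRoot.associated_natCast_sub_one_pow {A : Type*} [CommRing A] [IsDomain A] {p : ℕ}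
    (hp : p.Prime) {ε : A} (hε : IsPrimitiveRoot ε p) :
    Associated (p : A) ((ε - 1) ^ (p - 1)) := by
  have : Fact p.Prime := ⟨hp⟩
  have h1 : (p : A) = ∏ μ ∈ primitiveRoots p A, (1 - μ) := by
    rw [← eval_one_cyclotomic_prime (R := A) (p := p),
      cyclotomic_eq_prod_X_sub_primitiveRoots hε, eval_prod]
    simp
  have h2 : (ε - 1) ^ (p - 1) = ∏ μ ∈ primitiveRoots p A, (ε - 1) := by
    rw [Finset.prod_const, hε.card_primitiveRoots, Nat.totient_prime hp]
  rw [h1, h2]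
  refine Associated.prod _ _ _ fun μ hμ ↦ ?_
  obtain ⟨i, -, hi, rfl⟩ := (hε.isPrimitiveRoot_iff).mp (isPrimitiveRoot_of_mem_primitiveRoots hμ)
  have := (hε.associated_sub_one_pow_sub_one_of_coprime hi).symm
  rwa [← neg_sub, Associated.neg_left_iff]

/-- Since `p` is associated to `(ε - 1) ^ (p - 1)`, the bound `p / (p - 1) * ord_Q(p)` is the order
of `(ε - 1) ^ p`. -/
lemma powerOrdBound_iff {S : Type*} [CommRing S] (Q : Ideal S) [Q.IsPrime]
    [IsDomain (Localization.AtPrime Q)] [IsDiscreteValuationRing (Localization.AtPrime Q)]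
    {p : ℕ} (hp : p.Prime) (hp0 : (p : Localization.AtPrime Q) ≠ 0)
    {ε : Localization.AtPrime Q} (hε : IsPrimitiveRoot ε p) (g : Localization.AtPrime Q) :
    PowerOrdBound p Q g ↔ ∃ y, (ε - 1) ^ p ∣ g - y ^ p := by
  have hpl := hε.associated_natCast_sub_one_pow hp
  have hp1 : p - 1 ≠ 0 := by have := hp.two_le; lia
  have hl0 : ε - 1 ≠ 0 := fun h ↦ by
    rw [h, zero_pow hp1, associated_zero_iff_eq_zero] at hpl
    exact hp0 hpl
  obtain ⟨π, hπ⟩ := IsDiscreteValuationRing.exists_irreducible (Localization.AtPrime Q)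
  obtain ⟨c, hc⟩ := IsDiscreteValuationRing.associated_pow_irreducible hl0 hπ
  have hord : primeOrd Q (p : S) = ((p - 1) * c : ℕ) := by
    rw [primeOrd, idealOrd_maximalIdeal_eq_addVal, map_natCast,
      (IsDiscreteValuationRing.addVal_eq_iff_associated _ _).mpr hpl,
      IsDiscreteValuationRing.addVal_pow,
      (IsDiscreteValuationRing.addVal_eq_iff_associated _ _).mpr hc, hπ.addVal_pow, nsmul_eq_mul,
      Nat.cast_mul]
  have hcast : ((p : ℝ≥0∞) / ((p : ℝ≥0∞) - 1)) * ((primeOrd Q (p : S) : ℕ∞) : ℝ≥0∞) =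
      ((((p * c : ℕ) : ℕ∞)) : ℝ≥0∞) := by
    have h1 : (p : ℝ≥0∞) - 1 = ((p - 1 : ℕ) : ℝ≥0∞) := by
      rw [ENNReal.natCast_sub, Nat.cast_one]
    rw [hord, h1, ENat.toENNReal_coe, ENat.toENNReal_coe, Nat.cast_mul, Nat.cast_mul, ← mul_assoc,
      ENNReal.div_mul_cancel (Nat.cast_ne_zero.mpr hp1) (ENNReal.natCast_ne_top _)]
  rw [PowerOrdBound, hcast, ENat.toENNReal_le, natCast_le_powerOrd_iff]
  refine exists_congr fun y ↦ ?_
  rw [hπ.maximalIdeal_eq, Ideal.span_singleton_pow, Ideal.mem_span_singleton, mul_comm, pow_mul,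
    (hc.pow_pow (n := p)).dvd_iff_dvd_left]

/-! ### Adjoining `p`-th roots in tamely ramified extensions -/

/-- In a valuation ring, an element not divisible by `l` is associated to its translates
by multiples of `l`. -/
lemma ValuationRing.associated_of_dvd_sub {W : Type*} [CommRing W] [IsDomain W] [ValuationRing W]
    {l x x' : W} (hlx : ¬ l ∣ x) (h : l ∣ x - x') : Associated x x' := by
  obtain ⟨t, rfl⟩ := (ValuationRing.dvd_total l x).resolve_left hlx
  obtain ⟨s, hs⟩ := h
  have ht : ¬ IsUnit t := fun ht ↦ hlx (by rw [ht.mul_right_dvd])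
  have hu : IsUnit (1 - t * s) := by
    refine (IsLocalRing.isUnit_or_isUnit_one_sub_self (t * s)).resolve_left fun h ↦ ht ?_
    exact isUnit_of_mul_isUnit_left h
  refine ⟨hu.unit, ?_⟩
  rw [IsUnit.unit_spec]
  linear_combination hs

/-- In a separable extension of characteristic `p`, an element whose `p`-th power lies in the base
field is itself in the base field. -/
lemma Algebra.IsSeparable.mem_range_of_pow_mem_range {k l : Type*} [Field k] [Field l]
    [Algebra k l] [Algebra.IsSeparable k l] (p : ℕ) [ExpChar k p] {x : l}
    (h : x ^ p ∈ (algebraMap k l).range) : x ∈ (algebraMap k l).range := by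
  have h1 : x ∈ perfectClosure k l := mem_perfectClosure_iff_pow_mem p |>.mpr ⟨1, by simpa using h⟩
  rw [perfectClosure.eq_bot_of_isSeparable] at h1
  exact h1

/-- The cross terms of `(x + π ^ n z) ^ p` have higher order than `π ^ (p n)` as long as `n` is
smaller than the order `c` of `ε - 1`. -/
lemma dvd_prime_mul_pow {A : Type*} [CommRing A] {p : ℕ} (hp : p.Prime) {π : A} {c n : ℕ}
    (hn : n < c) (h : π ^ (c * (p - 1)) ∣ (p : A)) : π ^ (p * n + 1) ∣ (p : A) * π ^ n := by
  refine (pow_dvd_pow π ?_).trans (pow_add π (c * (p - 1)) n ▸ mul_dvd_mul_right h _)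
  obtain ⟨q, rfl⟩ : ∃ q, p = q + 2 := ⟨p - 2, by have := hp.two_le; lia⟩
  obtain ⟨d, rfl⟩ : ∃ d, c = n + 1 + d := ⟨c - n - 1, by lia⟩
  have : q + 2 - 1 = q + 1 := by lia
  rw [this]
  nlinarith [Nat.zero_le (d * (q + 1))]

open IsDiscreteValuationRing in
/-- If a `p`-th root of `f` exists in a tamely ramified extension of discrete valuation rings with
residue characteristic `p`, then `f` is, up to `p`-th powers, a unit congruent to a `p`-th power
modulo `(ε - 1) ^ p`.

As the ramification index is prime to `p`, the order of `f` is divisible by `p`, which reduces the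
claim to a unit `u = η ^ p`. Take `y` with `u - y ^ p` of the largest order `m`, and suppose that
`m` is smaller than the order of `(ε - 1) ^ p`. The factors of `η ^ p - y ^ p = ∏ (η - ζ y)` then
have equal orders, so `p` divides `m`, say `m = p n`, and `η = y + π ^ n θ`. The `p`-th power of the
residue of `θ` lies in the residue field of `V`, hence by separability so does the residue of `θ`.
If `b` in `V` lifts it, then `y + π ^ n b` is a better approximation than `y`. -/
theorem IsTamelyRamified.exists_eq_pow_mul {V W : Type*} [CommRing V] [IsDomain V]
    [IsDiscreteValuationRing V] [CommRing W] [IsDomain W] [IsDiscreteValuationRing W]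
    (φ : V →+* W) [IsLocalHom φ] (hφ : Function.Injective φ) (htame : IsTamelyRamified φ)
    {p : ℕ} (hp : p.Prime) (hp0 : (p : V) ≠ 0) (hpV : (p : V) ∈ IsLocalRing.maximalIdeal V)
    {ε : V} (hε : IsPrimitiveRoot ε p) {f : V} (hf : f ≠ 0) {ω : W} (hω : ω ^ p = φ f) :
    ∃ h g, f = h ^ p * g ∧ IsUnit g ∧ ∃ y, (ε - 1) ^ p ∣ g - y ^ p := by
  have : NeZero p := ⟨hp.ne_zero⟩
  have : Fact p.Prime := ⟨hp⟩
  obtain ⟨hsep, π, hπ, e, he, hcop⟩ := htame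
  have hchar : CharP (IsLocalRing.ResidueField V) p := by
    have h0 : ((p : ℕ) : IsLocalRing.ResidueField V) = 0 := by
      rw [← map_natCast (IsLocalRing.residue V), IsLocalRing.residue_eq_zero_iff]
      exact hpV
    exact (CharP.charP_iff_prime_eq_zero hp).mpr h0
  rw [ringChar.eq _ p] at hcop
  rw [idealOrd_maximalIdeal_eq_addVal] at he
  have hπ0 : π ≠ 0 := hπ.ne_zero
  have hφπ0 : φ π ≠ 0 := (map_ne_zero_iff φ hφ).mpr hπ0
  -- the order of `f` is divisible by `p`
  obtain ⟨k, u, hku⟩ : ∃ (k : ℕ) (u : Vˣ), f = (π ^ k) ^ p * u := by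
    obtain ⟨n, u, hu⟩ := eq_unit_mul_pow_irreducible hf hπ
    have h1 : addVal W (ω ^ p) = (n * e : ℕ) := by
      rw [hω, hu, map_mul, map_pow, addVal_mul, addVal_pow, he,
        (addVal_eq_zero_iff).mpr (u.isUnit.map φ), zero_add, nsmul_eq_mul, Nat.cast_mul]
    have hω0 : addVal W ω ≠ ⊤ := fun h ↦ by
      rw [addVal_eq_top_iff] at h
      rw [h, zero_pow hp.ne_zero] at hω
      exact hf ((map_eq_zero_iff φ hφ).mp hω.symm)
    obtain ⟨w, hw⟩ := ENat.ne_top_iff_exists.mp hω0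
    rw [addVal_pow, ← hw, nsmul_eq_mul] at h1
    have h2 : p * w = n * e := by exact_mod_cast h1
    obtain ⟨k, rfl⟩ := (Nat.Coprime.symm hcop).dvd_of_dvd_mul_right ⟨w, h2.symm⟩
    exact ⟨k, u, by rw [hu, mul_comm, mul_comm p, pow_mul]⟩
  refine ⟨π ^ k, u, hku, u.isUnit, ?_⟩
  obtain ⟨η, hη⟩ : ∃ η : W, η ^ p = φ u := by
    have h1 : φ (π ^ k) ^ p ∣ ω ^ p := by
      rw [hω, hku, map_mul, map_pow φ (π ^ k) p]
      exact dvd_mul_right _ _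
    obtain ⟨η, rfl⟩ := (IsIntegrallyClosed.pow_dvd_pow_iff hp.ne_zero).mp h1
    refine ⟨η, mul_left_cancel₀
      (pow_ne_zero p ((map_ne_zero_iff φ hφ).mpr (pow_ne_zero k hπ0))) ?_⟩
    rw [← mul_pow, hω, hku, map_mul, map_pow φ (π ^ k) p]
  -- otherwise choose a `p`-th power approximating `u` as well as possible
  by_contra hcon
  have hpl := hε.associated_natCast_sub_one_pow hp
  have hl0 : ε - 1 ≠ 0 := fun h ↦ by
    rw [h, zero_pow (by have := hp.two_le; lia), associated_zero_iff_eq_zero] at hpl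
    exact hp0 hpl
  obtain ⟨c, hc⟩ := associated_pow_irreducible hl0 hπ
  have hcp : π ^ (c * (p - 1)) ∣ (p : V) := by
    rw [pow_mul]
    exact ((hpl.trans (hc.pow_pow)).symm).dvd
  classical
  have hex : ∃ N, ¬ ∃ y, π ^ N ∣ (u : V) - y ^ p := by
    refine ⟨c * p, ?_⟩
    rw [pow_mul]
    rintro ⟨y, hy⟩
    exact hcon ⟨y, (hc.pow_pow).dvd.trans hy⟩
  obtain ⟨m, hm⟩ : ∃ m, Nat.find hex = m + 1 := by
    refine Nat.exists_eq_succ_of_ne_zero fun h ↦ ?_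
    exact ((Nat.find_eq_zero hex).mp h) ⟨0, by simp⟩
  have hmax : ¬ ∃ y, π ^ (m + 1) ∣ (u : V) - y ^ p := hm ▸ Nat.find_spec hex
  have hmc : m < c * p := by
    have : Nat.find hex ≤ c * p := Nat.find_min' hex (by
      rw [pow_mul]
      rintro ⟨y, hy⟩
      exact hcon ⟨y, (hc.pow_pow).dvd.trans hy⟩)
    lia
  obtain ⟨y, a, ha⟩ : ∃ y, π ^ m ∣ (u : V) - y ^ p := not_not.mp (Nat.find_min hex (by lia))
  have haunit : IsUnit a := by
    by_contra hna
    rw [← mem_nonunits_iff, ← IsLocalRing.mem_maximalIdeal, hπ.maximalIdeal_eq,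
      Ideal.mem_span_singleton] at hna
    obtain ⟨b, rfl⟩ := hna
    exact hmax ⟨y, b, by rw [ha, pow_succ]; ring⟩
  have hasub : φ ((u : V) - y ^ p) = η ^ p - φ y ^ p := by rw [map_sub, hη, map_pow]
  have hεW : IsPrimitiveRoot (φ ε) p := hε.map_of_injective hφ
  have hprod := hεW.pow_sub_pow_eq_prod_sub_mul η (φ y) hp.pos
  -- some factor `η - ζ y`, and hence every one, is not divisible by `ε - 1`
  obtain ⟨ζ₀, hζ₀, hndvd⟩ : ∃ ζ ∈ nthRootsFinset p (1 : W), ¬ φ ε - 1 ∣ η - ζ * φ y := by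
    by_contra! hall
    have h1 : (φ ε - 1) ^ p ∣ φ ((u : V) - y ^ p) := by
      have h2 := Finset.prod_dvd_prod_of_dvd _ _ hall
      rwa [Finset.prod_const, hεW.card_nthRootsFinset, ← hprod, ← hasub] at h2
    have h2 : φ π ^ (c * p) ∣ φ π ^ m := by
      rw [ha, map_mul, map_pow, (haunit.map φ).dvd_mul_right] at h1
      refine dvd_trans ?_ h1
      rw [pow_mul]
      refine pow_dvd_pow_of_dvd ?_ p
      have := map_dvd φ hc.symm.dvd
      rwa [map_pow, map_sub, map_one] at this
    have hnu : ¬ IsUnit (φ π) := fun h ↦ hπ.not_isUnit (isUnit_of_map_unit φ π h)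
    exact absurd ((pow_dvd_pow_iff hφπ0 hnu).mp h2) (by lia)
  have hassoc : ∀ ζ ∈ nthRootsFinset p (1 : W), Associated (η - ζ₀ * φ y) (η - ζ * φ y) := by
    intro ζ hζ
    refine ValuationRing.associated_of_dvd_sub hndvd ?_
    have := hεW.sub_one_dvd_sub hp hζ hζ₀
    refine (this.mul_right (φ y)).trans (dvd_of_eq ?_)
    ring
  have h1mem : (1 : W) ∈ nthRootsFinset p (1 : W) := by
    rw [mem_nthRootsFinset hp.pos, one_pow]
  have hpow : Associated ((η - φ y) ^ p) (φ π ^ m) := by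
    have h1 : Associated (∏ ζ ∈ nthRootsFinset p (1 : W), (η - 1 * φ y))
        (∏ ζ ∈ nthRootsFinset p (1 : W), (η - ζ * φ y)) :=
      Associated.prod _ _ _ fun ζ hζ ↦ (hassoc 1 h1mem).symm.trans (hassoc ζ hζ)
    rw [Finset.prod_const, hεW.card_nthRootsFinset, one_mul, ← hprod, ← hasub, ha, map_mul,
      map_pow] at h1
    exact h1.trans (associated_mul_unit_left _ _ (haunit.map φ))
  have hw0 : addVal W (η - φ y) ≠ ⊤ := fun h ↦ by
    rw [addVal_eq_top_iff] at h
    rw [h, zero_pow hp.ne_zero] at hpow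
    exact pow_ne_zero m hφπ0 ((associated_zero_iff_eq_zero _).mp hpow.symm)
  obtain ⟨w, hw⟩ := ENat.ne_top_iff_exists.mp hw0
  have hwm : p * w = m * e := by
    have h1 := (addVal_eq_iff_associated _ _).mpr hpow
    rw [addVal_pow, addVal_pow, he, ← hw, nsmul_eq_mul, nsmul_eq_mul] at h1
    exact_mod_cast h1
  obtain ⟨n, rfl⟩ := (Nat.Coprime.symm hcop).dvd_of_dvd_mul_right ⟨w, hwm.symm⟩
  have hnc : n < c := by
    rw [mul_comm c] at hmc
    exact lt_of_mul_lt_mul_left hmc (Nat.zero_le p)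
  obtain ⟨θ, hθ⟩ : φ π ^ n ∣ η - φ y := by
    refine ((addVal_eq_iff_associated _ _).mp ?_).dvd
    rw [addVal_pow, he, ← hw, nsmul_eq_mul]
    have : w = n * e := by
      refine Nat.eq_of_mul_eq_mul_left hp.pos ?_
      rw [hwm, mul_assoc]
    exact_mod_cast this.symm
  -- the residue of `θ` is a `p`-th root of that of `a`, so it lies in the residue field of `V`
  obtain ⟨s, hs⟩ := dvd_prime_mul_pow hp hnc hcp
  have hsW : (p : W) * φ π ^ n = φ π ^ (p * n + 1) * φ s := by
    simpa using congrArg φ hs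
  have hθa : IsLocalRing.residue W (φ a) = IsLocalRing.residue W θ ^ p := by
    obtain ⟨r, hr⟩ := exists_add_pow_prime_eq hp (φ y) (φ π ^ n * θ)
    have h1 : φ π ^ (p * n) * φ a = φ π ^ (p * n) * (θ ^ p + φ π * (φ s * φ y * θ * r)) := by
      rw [← map_pow, ← map_mul, ← ha, hasub, show η = φ y + φ π ^ n * θ by rw [← hθ]; ring, hr]
      rw [mul_pow, ← pow_mul, mul_comm n p, map_pow]
      linear_combination φ y * θ * r * hsW
    have h2 := mul_left_cancel₀ (pow_ne_zero _ hφπ0) h1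
    have h3 : IsLocalRing.residue W (φ π) = 0 := by
      rw [IsLocalRing.residue_eq_zero_iff, IsLocalRing.mem_maximalIdeal, mem_nonunits_iff]
      exact fun h ↦ hπ.not_isUnit (isUnit_of_map_unit φ π h)
    rw [h2, map_add, map_mul, h3, zero_mul, add_zero, map_pow]
  obtain ⟨b, hb⟩ : ∃ b : V, IsLocalRing.residue W (φ b) = IsLocalRing.residue W θ := by
    let := (IsLocalRing.ResidueField.map φ).toAlgebra
    have : ExpChar (IsLocalRing.ResidueField V) p := ExpChar.prime hp
    obtain ⟨b, hb⟩ := Algebra.IsSeparable.mem_range_of_pow_mem_range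
      (k := IsLocalRing.ResidueField V) p (x := IsLocalRing.residue W θ)
      ⟨IsLocalRing.residue V a, by rw [← hθa]; rfl⟩
    obtain ⟨b, rfl⟩ := IsLocalRing.residue_surjective b
    exact ⟨b, hb⟩
  have hab : π ∣ a - b ^ p := by
    rw [← Ideal.mem_span_singleton, ← hπ.maximalIdeal_eq, IsLocalRing.mem_maximalIdeal,
      mem_nonunits_iff]
    intro hunit
    have h1 := hunit.map φ
    have h2 : IsLocalRing.residue W (φ (a - b ^ p)) = 0 := by
      rw [map_sub, map_sub, map_pow, map_pow, hb, hθa, sub_self]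
    rw [IsLocalRing.residue_eq_zero_iff, IsLocalRing.mem_maximalIdeal, mem_nonunits_iff] at h2
    exact h2 h1
  -- which gives a better approximation of `u`
  obtain ⟨t, ht⟩ := hab
  obtain ⟨r, hr⟩ := exists_add_pow_prime_eq hp y (π ^ n * b)
  refine hmax ⟨y + π ^ n * b, t - s * y * b * r, ?_⟩
  rw [hr, mul_pow, ← pow_mul, mul_comm n p, pow_succ]
  rw [pow_succ] at hs
  linear_combination ha + π ^ (p * n) * ht - y * b * r * hs

/-! ### Étale monogenic extensions -/

/-- If an integral element `θ` generates `L` over `K` and the derivative of its minimal polynomial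
takes a unit value at `θ`, then the discriminant of `1, θ, θ², …` is a unit up to sign, as it is the
norm of that value. Therefore the integral closure of the base ring in `L` is generated by `θ`. -/
lemma Algebra.adjoin_eq_top_of_isUnit_derivative {V W : Type*} (K L : Type*) [CommRing V]
    [IsDomain V] [IsIntegrallyClosed V] [CommRing W] [IsDomain W] [Algebra V W]
    [Field K] [Field L] [Algebra V K] [IsFractionRing V K] [Algebra W L] [IsFractionRing W L]
    [Algebra K L] [Algebra V L] [IsScalarTower V K L] [IsScalarTower V W L]
    [Algebra.IsIntegral V W] [CharZero K] {θ : W}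
    (hgen : Algebra.adjoin K {algebraMap W L θ} = ⊤)
    (hunit : IsUnit (aeval θ (derivative (minpoly V θ)))) :
    Algebra.adjoin V {θ} = ⊤ := by
  have hθ : IsIntegral V θ := Algebra.IsIntegral.isIntegral θ
  have hθL : IsIntegral V (algebraMap W L θ) := hθ.algebraMap
  have hθK : IsIntegral K (algebraMap W L θ) := hθL.tower_top
  let pb : PowerBasis K L := PowerBasis.ofAdjoinEqTop hθK hgen
  have hpb : pb.gen = algebraMap W L θ := PowerBasis.ofAdjoinEqTop_gen hθK hgen
  have : FiniteDimensional K L := pb.finite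
  have hinj : Function.Injective (algebraMap W L) := IsFractionRing.injective W L
  have : FaithfulSMul V W := by
    have h1 : Function.Injective (algebraMap V L) := by
      rw [IsScalarTower.algebraMap_eq V K L]
      exact (algebraMap K L).injective.comp (IsFractionRing.injective V K)
    rw [IsScalarTower.algebraMap_eq V W L, RingHom.coe_comp] at h1
    exact (faithfulSMul_iff_algebraMap_injective V W).mpr h1.of_comp
  have hder : aeval pb.gen (derivative (minpoly K pb.gen)) =
      algebraMap W L (aeval θ (derivative (minpoly V θ))) := by
    rw [hpb, minpoly.isIntegrallyClosed_eq_field_fractions K L hθ, derivative_map,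
      aeval_map_algebraMap, aeval_algebraMap_apply]
  obtain ⟨u, hu⟩ := hunit
  have hnorm : ∃ c : V, c • Algebra.discr K pb.basis = 1 := by
    have h1 : IsIntegral V (Algebra.norm K (algebraMap W L (↑u⁻¹ : W))) :=
      Algebra.isIntegral_norm K (Algebra.IsIntegral.isIntegral (R := V) (↑u⁻¹ : W)).algebraMap
    obtain ⟨c, hc⟩ := IsIntegrallyClosed.isIntegral_iff.mp h1
    refine ⟨(-1) ^ (Module.finrank K L * (Module.finrank K L - 1) / 2) * c, ?_⟩
    rw [Algebra.discr_powerBasis_eq_norm, hder, ← hu, Algebra.smul_def, map_mul, hc, map_pow,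
      map_neg, map_one]
    have h2 : Algebra.norm K (algebraMap W L (↑u⁻¹ : W)) *
        Algebra.norm K (algebraMap W L u) = 1 := by
      rw [← map_mul, ← map_mul, Units.inv_mul, map_one, map_one]
    have h3 : ((-1 : K) ^ (Module.finrank K L * (Module.finrank K L - 1) / 2)) ^ 2 = 1 := by
      rw [← pow_mul, mul_comm, pow_mul, neg_one_sq, one_pow]
    linear_combination (((-1 : K) ^ (Module.finrank K L * (Module.finrank K L - 1) / 2)) ^ 2) * h2 +
      h3
  obtain ⟨c, hc⟩ := hnorm
  refine top_le_iff.mp fun z _ ↦ ?_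
  have hz : IsIntegral V (algebraMap W L z) :=
    (Algebra.IsIntegral.isIntegral (R := V) z).algebraMap
  have h1 := Algebra.discr_mul_isIntegral_mem_adjoin K (B := pb) (hpb ▸ hθL) hz
  have h2 := Subalgebra.smul_mem _ h1 c
  rw [← smul_assoc, hc, one_smul, hpb, ← Set.image_singleton] at h2
  have h3 : algebraMap W L z ∈ (Algebra.adjoin V {θ}).map (IsScalarTower.toAlgHom V W L) := by
    rw [AlgHom.map_adjoin]
    exact h2
  obtain ⟨w, hw, hwz⟩ := h3
  exact hinj hwz ▸ hw

/-- A monogenic extension of a normal domain is étale where the derivative of the minimal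
polynomial is invertible. -/
lemma Algebra.Etale.of_adjoin_eq_top {V W : Type*} [CommRing V] [IsDomain V] [IsIntegrallyClosed V]
    [CommRing W] [IsDomain W] [Algebra V W] [FaithfulSMul V W] {θ : W} (hθ : IsIntegral V θ)
    (htop : Algebra.adjoin V {θ} = ⊤)
    (hunit : IsUnit (aeval θ (derivative (minpoly V θ)))) : Algebra.Etale V W := by
  have hsurj : ∀ w : W, ∃ q : V[X], aeval θ q = w := fun w ↦ by
    have : w ∈ Algebra.adjoin V {θ} := htop ▸ trivial
    rw [Algebra.adjoin_singleton_eq_range_aeval] at this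
    exact this
  obtain ⟨u, hu⟩ := hunit.exists_right_inv
  obtain ⟨q, rfl⟩ := hsurj u
  have hdvd : minpoly V θ ∣ derivative (minpoly V θ) * q - 1 := by
    rw [← minpoly.isIntegrallyClosed_dvd_iff hθ, map_sub, map_mul, hu, map_one, sub_self]
  obtain ⟨r, hr⟩ := hdvd
  -- the localization in the definition of standard étale algebras is at `1`
  let P : StandardEtalePair V :=
    ⟨minpoly V θ, minpoly.monic hθ, 1, q, -r, 0, by linear_combination hr⟩
  have hmap : P.HasMap θ := ⟨minpoly.aeval V θ, by simp [P]⟩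
  have : Algebra.IsStandardEtale V W := by
    refine ⟨⟨⟨P, θ, hmap, ?_, ?_⟩⟩⟩
    · rw [injective_iff_map_eq_zero]
      intro x hx
      let P' : StandardEtalePresentation V P.Ring :=
        ⟨P, P.X, P.hasMap_X, by simpa [StandardEtalePair.lift_X_left] using Function.bijective_id⟩
      obtain ⟨s, n, hs⟩ := P'.exists_mul_aeval_x_g_pow_eq_aeval_x x
      have hx' : x = aeval P.X s := by simpa [P', P] using hs
      subst hx'
      rw [← aeval_algHom_apply, P.lift_X, minpoly.isIntegrallyClosed_dvd_iff hθ] at hx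
      obtain ⟨t, rfl⟩ := hx
      have h0 : aeval P.X (minpoly V θ) = 0 := P.hasMap_X.1
      rw [map_mul, h0, zero_mul]
    · intro w
      obtain ⟨s, rfl⟩ := hsurj w
      exact ⟨aeval P.X s, by rw [← aeval_algHom_apply, P.lift_X]⟩
  infer_instance

/-- Étaleness of the normalization of `V` in `K(θ)`, when `θ` is a root of a monic polynomial `F`
such that `F'(θ)` is a unit. -/
theorem Algebra.Etale.of_isUnit_aeval_derivative {V W : Type*} (K L : Type*) [CommRing V]
    [IsDomain V] [IsIntegrallyClosed V] [CommRing W] [IsDomain W] [Algebra V W]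
    [Field K] [Field L] [Algebra V K] [IsFractionRing V K] [Algebra W L] [IsFractionRing W L]
    [Algebra K L] [Algebra V L] [IsScalarTower V K L] [IsScalarTower V W L]
    [Algebra.IsIntegral V W] [FaithfulSMul V W] [CharZero K] {θ : W}
    (hgen : Algebra.adjoin K {algebraMap W L θ} = ⊤) {F : V[X]} (hF : aeval θ F = 0)
    (hunit : IsUnit (aeval θ (derivative F))) : Algebra.Etale V W := by
  have hθ : IsIntegral V θ := Algebra.IsIntegral.isIntegral θ
  have hunit' : IsUnit (aeval θ (derivative (minpoly V θ))) := by
    obtain ⟨G, hG⟩ := (minpoly.isIntegrallyClosed_dvd_iff hθ F).mp hF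
    rw [hG, derivative_mul, map_add, map_mul, map_mul, minpoly.aeval, zero_mul, add_zero] at hunit
    exact isUnit_of_mul_isUnit_left hunit
  exact Algebra.Etale.of_adjoin_eq_top hθ
    (Algebra.adjoin_eq_top_of_isUnit_derivative K L hgen hunit') hunit'

/-! ### Étale Kummer extensions -/

/-- The substitution `η = l θ + y` in the Kummer equation `η ^ p = g`, where `g` is congruent to
`y ^ p` modulo `l ^ p` and `p = u l ^ (p - 1)`: divided by `l ^ p`, the equation becomes monic
in `θ`. -/
lemma exists_monic_mul_eq_add_pow_sub {V : Type*} [CommRing V] [IsDomain V] {p : ℕ} (hp : p.Prime)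
    {l u y g : V} (hu : (p : V) = u * l ^ (p - 1)) (hg : l ^ p ∣ g - y ^ p) :
    ∃ F : V[X], F.Monic ∧ C (l ^ p) * F = (C l * X + C y) ^ p - C g := by
  obtain ⟨a, ha⟩ := hg
  set G : V[X] := C u * ∑ k ∈ Finset.Ioo 0 p,
    C (l ^ (k - 1) * y ^ (p - k) * ((p.choose k / p : ℕ) : V)) * X ^ k - C a with hG
  have hdeg : G.degree < p := by
    refine (degree_sub_le _ _).trans_lt (max_lt ?_ ?_)
    · rw [Finset.mul_sum]
      refine (degree_sum_le _ _).trans_lt ((Finset.sup_lt_iff (WithBot.bot_lt_coe _)).mpr ?_)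
      intro k hk
      rw [← mul_assoc, ← C_mul]
      exact (degree_C_mul_X_pow_le k _).trans_lt (by exact_mod_cast (Finset.mem_Ioo.mp hk).2)
    · exact degree_C_le.trans_lt (by exact_mod_cast hp.pos)
  refine ⟨X ^ p + G, monic_X_pow_add hdeg, ?_⟩
  rw [add_pow_prime_eq' hp, hG]
  have hsum : C (l ^ p) * (C u * ∑ k ∈ Finset.Ioo 0 p,
      C (l ^ (k - 1) * y ^ (p - k) * ((p.choose k / p : ℕ) : V)) * X ^ k) =
      (p : V[X]) * ∑ k ∈ Finset.Ioo 0 p,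
        (C l * X) ^ k * C y ^ (p - k) * ((p.choose k / p : ℕ) : V[X]) := by
    rw [Finset.mul_sum, Finset.mul_sum, Finset.mul_sum]
    refine Finset.sum_congr rfl fun k hk ↦ ?_
    have hk0 := (Finset.mem_Ioo.mp hk).1
    have hp' : (p : V[X]) = C u * C l ^ (p - 1) := by
      rw [← C_pow, ← C_mul, ← hu, C_eq_natCast]
    obtain ⟨j, rfl⟩ : ∃ j, k = j + 1 := ⟨k - 1, by lia⟩
    obtain ⟨q, rfl⟩ : ∃ q, p = q + 1 := ⟨p - 1, by have := hp.pos; lia⟩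
    rw [hp']
    simp only [C_mul, C_pow, C_eq_natCast, Nat.add_sub_cancel, mul_pow]
    ring
  have ha' : (C g : V[X]) - C y ^ p = C (l ^ p) * C a := by rw [← C_mul, ← ha]; simp
  rw [mul_add, mul_sub, hsum, mul_pow, C_pow]
  rw [C_pow] at ha'
  linear_combination ha'

/-- Adjoining a `p`-th root `η` of a unit `g` which is congruent to a `p`-th power `y ^ p` modulo
`l ^ p`, where `l ^ (p - 1)` is associated to `p`, is étale: `θ = (η - y) / l` satisfies a monic
equation `F(θ) = 0` with `F'(θ)` associated to `η ^ (p - 1)`. -/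
theorem Algebra.Etale.of_pow_eq_pow_mul {V W : Type*} (K L : Type*) [CommRing V]
    [IsDomain V] [IsIntegrallyClosed V] [CommRing W] [IsDomain W] [IsIntegrallyClosed W]
    [Algebra V W] [Field K] [Field L] [Algebra V K] [IsFractionRing V K] [Algebra W L]
    [IsFractionRing W L] [Algebra K L] [Algebra V L] [IsScalarTower V K L] [IsScalarTower V W L]
    [Algebra.IsIntegral V W] [FaithfulSMul V W] [CharZero K] {p : ℕ} (hp : p.Prime)
    {k g l y : V} (u : Vˣ) (hk0 : k ≠ 0) (hl0 : l ≠ 0) (hg : IsUnit g)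
    (hu : (p : V) = u * l ^ (p - 1)) (hy : l ^ p ∣ g - y ^ p) {ω : W}
    (hω : ω ^ p = algebraMap V W (k ^ p * g))
    (hgen : Algebra.adjoin K {algebraMap W L ω} = ⊤) : Algebra.Etale V W := by
  have hinjVW : Function.Injective (algebraMap V W) := FaithfulSMul.algebraMap_injective V W
  have hinjVL : Function.Injective (algebraMap V L) := by
    rw [IsScalarTower.algebraMap_eq V W L]
    exact (IsFractionRing.injective W L).comp hinjVW
  have hl0L : algebraMap V L l ≠ 0 := (map_ne_zero_iff _ hinjVL).mpr hl0
  obtain ⟨F, hFm, hF⟩ := exists_monic_mul_eq_add_pow_sub hp hu hy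
  rw [map_mul, map_pow] at hω
  obtain ⟨η, hη⟩ := (IsIntegrallyClosed.pow_dvd_pow_iff hp.ne_zero).mp ⟨_, hω⟩
  have hηg : η ^ p = algebraMap V W g := by
    refine mul_left_cancel₀ (pow_ne_zero p ((map_ne_zero_iff _ hinjVW).mpr hk0)) ?_
    rw [← hω, hη, mul_pow]
  obtain ⟨θ, hθ⟩ : ∃ θ : W, algebraMap V W l * θ = η - algebraMap V W y := by
    set t : L := (algebraMap W L η - algebraMap V L y) / algebraMap V L l
    have ht : algebraMap V L l * t + algebraMap V L y = algebraMap W L η := by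
      rw [mul_div_cancel₀ _ hl0L, sub_add_cancel]
    have h1 := congrArg (aeval t) hF
    simp only [map_mul, map_sub, map_pow, map_add, aeval_C, aeval_X] at h1
    rw [ht, ← map_pow (algebraMap W L), hηg, ← IsScalarTower.algebraMap_apply, sub_self] at h1
    have h2 : aeval t F = 0 := (mul_eq_zero.mp h1).resolve_left (pow_ne_zero _ hl0L)
    have h3 : IsIntegral V t := ⟨F, hFm, by rwa [← aeval_def]⟩
    obtain ⟨θ, hθ⟩ := IsIntegrallyClosed.isIntegral_iff.mp (h3.tower_top (A := W))
    refine ⟨θ, IsFractionRing.injective W L ?_⟩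
    rw [map_mul, map_sub, hθ, ← IsScalarTower.algebraMap_apply, ← IsScalarTower.algebraMap_apply,
      ← ht]
    ring
  have hθη : algebraMap V W l * θ + algebraMap V W y = η := by rw [hθ, sub_add_cancel]
  have hl0W : algebraMap V W l ≠ 0 := (map_ne_zero_iff _ hinjVW).mpr hl0
  have hroot : aeval θ F = 0 := by
    have h1 := congrArg (aeval θ) hF
    simp only [map_mul, map_sub, map_pow, map_add, aeval_C, aeval_X] at h1
    rw [hθη, hηg, sub_self] at h1
    exact (mul_eq_zero.mp h1).resolve_left (pow_ne_zero _ hl0W)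
  have hder : IsUnit (aeval θ (derivative F)) := by
    have h0 : C (l ^ p) * derivative F = derivative ((C l * X + C y) ^ p - C g) := by
      rw [← hF, derivative_C_mul]
    have h1 := congrArg (aeval θ) h0
    simp only [derivative_sub, derivative_pow, derivative_C_mul, derivative_X, derivative_C,
      mul_one, add_zero, sub_zero, map_mul, map_pow, map_add, aeval_C, aeval_X,
      hθη] at h1
    have h2 : algebraMap V W l ^ p * aeval θ (derivative F) =
        algebraMap V W l ^ p * (algebraMap V W u * η ^ (p - 1)) := by
      have hlp : algebraMap V W l ^ p = algebraMap V W l ^ (p - 1) * algebraMap V W l := by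
        rw [← pow_succ, Nat.sub_add_cancel hp.one_le]
      rw [h1, hu, hlp, map_mul, map_pow]
      ring
    rw [mul_left_cancel₀ (pow_ne_zero _ hl0W) h2]
    refine (u.isUnit.map _).mul (IsUnit.pow _ ?_)
    exact (isUnit_pow_iff hp.ne_zero).mp (hηg ▸ hg.map _)
  refine Algebra.Etale.of_isUnit_aeval_derivative K L ?_ hroot hder
  have hVB : ∀ v : V, algebraMap V L v ∈ Algebra.adjoin K {algebraMap W L θ} := fun v ↦ by
    rw [IsScalarTower.algebraMap_apply V K L]
    exact Subalgebra.algebraMap_mem _ _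
  rw [← top_le_iff, ← hgen]
  refine Algebra.adjoin_le (Set.singleton_subset_iff.mpr ?_)
  rw [hη, ← hθη, map_mul, map_add, map_mul, ← IsScalarTower.algebraMap_apply,
    ← IsScalarTower.algebraMap_apply, ← IsScalarTower.algebraMap_apply]
  exact mul_mem (hVB _) (add_mem (mul_mem (hVB _) (Algebra.self_mem_adjoin_singleton _ _)) (hVB _))

end

/-! ### Generators up to denominators -/

lemma Algebra.mem_adjoin_of_isScalarTower {S : Type*} (K : Type*) {L : Type*} [CommSemiring S]
    [CommSemiring K] [CommSemiring L] [Algebra S K] [Algebra K L] [Algebra S L]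
    [IsScalarTower S K L] {s : Set L} {x : L} (hx : x ∈ Algebra.adjoin S s) :
    x ∈ Algebra.adjoin K s := by
  induction hx using Algebra.adjoin_induction with
  | mem x hx => exact Algebra.subset_adjoin hx
  | algebraMap r =>
    rw [IsScalarTower.algebraMap_apply S K L]
    exact Subalgebra.algebraMap_mem _ _
  | add x y _ _ hx hy => exact add_mem hx hy
  | mul x y _ _ hx hy => exact mul_mem hx hy

lemma Algebra.algebraMap_mem_adjoin_singleton {S A B : Type*} [CommSemiring S] [CommSemiring A]
    [CommSemiring B] [Algebra S A] [Algebra A B] [Algebra S B] [IsScalarTower S A B] {ω a : A}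
    (ha : a ∈ Algebra.adjoin S {ω}) :
    algebraMap A B a ∈ Algebra.adjoin S {algebraMap A B ω} := by
  have := Set.mem_image_of_mem (IsScalarTower.toAlgHom S A B) ha
  rwa [← Subalgebra.coe_map, AlgHom.map_adjoin, Set.image_singleton] at this

/-- A subalgebra of a fraction field which is generated by an algebraic element and contains the
ring is everything. -/
lemma Algebra.adjoin_eq_top_of_isFractionRing {K R L : Type*} [Field K] [CommRing R]
    [Field L] [Algebra K L] [Algebra R L] [IsFractionRing R L] {x : L} (hx : IsIntegral K x)
    (h : ∀ r : R, algebraMap R L r ∈ Algebra.adjoin K {x}) : Algebra.adjoin K {x} = ⊤ := by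
  refine top_le_iff.mp fun z _ ↦ ?_
  obtain ⟨a, b, -, rfl⟩ := IsFractionRing.div_surjective (A := R) z
  have hb : IsAlgebraic K (algebraMap R L b) := by
    have h1 := adjoin_le_integralClosure hx (h b)
    exact (mem_integralClosure_iff K L |>.mp h1).isAlgebraic
  rw [div_eq_mul_inv]
  exact mul_mem (h a) (Subalgebra.inv_mem_of_algebraic _ (x := ⟨_, h b⟩) hb)

lemma IsIntegral.of_pow_eq_algebraMap {S A : Type*} [CommRing S] [CommRing A] [Algebra S A]
    {n : ℕ} (hn : 0 < n) {f : S} {ω : A} (hω : ω ^ n = algebraMap S A f) : IsIntegral S ω :=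
  .of_pow hn (hω ▸ isIntegral_algebraMap)

lemma Algebra.isIntegral_of_adjoin_eq_top {S A : Type*} [CommRing S] [CommRing A] [Algebra S A]
    {ω : A} (hω : IsIntegral S ω) (htop : Algebra.adjoin S {ω} = ⊤) : Algebra.IsIntegral S A :=
  ⟨fun a ↦ (mem_integralClosure_iff S A).mp
    (adjoin_le_integralClosure hω (htop ▸ trivial : a ∈ Algebra.adjoin S {ω}))⟩

section Normalization

variable {S A : Type*} [CommRing S] [CommRing A] [Algebra S A]

lemma integralClosure.isIntegrallyClosed_fractionRing [IsDomain A] :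
    IsIntegrallyClosed (integralClosure A (FractionRing A)) := by
  refine (isIntegrallyClosed_iff (FractionRing A)).mpr fun {x} hx ↦ ?_
  have : IsIntegral A x := isIntegral_trans (R := A) x hx
  exact ⟨⟨x, this⟩, rfl⟩

lemma integralClosure.isIntegral_fractionRing [Algebra.IsIntegral S A] :
    Algebra.IsIntegral S (integralClosure A (FractionRing A)) :=
  Algebra.IsIntegral.trans A

lemma integralClosure.faithfulSMul_fractionRing [FaithfulSMul S A] :
    FaithfulSMul S (integralClosure A (FractionRing A)) := by
  have h1 : Function.Injective (algebraMap S (FractionRing A)) := by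
    rw [IsScalarTower.algebraMap_eq S A (FractionRing A)]
    exact (IsFractionRing.injective A (FractionRing A)).comp (FaithfulSMul.algebraMap_injective S A)
  rw [IsScalarTower.algebraMap_eq S (integralClosure A (FractionRing A)) (FractionRing A),
    RingHom.coe_comp] at h1
  exact (faithfulSMul_iff_algebraMap_injective _ _).mpr h1.of_comp

/-- The normalization of a monogenic integral domain over a normal Noetherian domain of
characteristic zero is module finite. -/
lemma integralClosure.finite_of_adjoin_eq_top (K L : Type*) [Field K] [Field L] [Algebra S K]
    [IsFractionRing S K] [Algebra A L] [IsFractionRing A L] [Algebra K L] [Algebra S L]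
    [IsScalarTower S K L] [IsScalarTower S A L] [IsDomain S] [IsDomain A] [IsNoetherianRing S]
    [IsIntegrallyClosed S] [CharZero K] {ω : A} (hω : IsIntegral S ω)
    (htop : Algebra.adjoin S {ω} = ⊤) : Module.Finite S (integralClosure A L) := by
  have := Algebra.isIntegral_of_adjoin_eq_top hω htop
  have hωL : IsIntegral K (algebraMap A L ω) := (hω.algebraMap (B := L)).tower_top
  have htop' : Algebra.adjoin K {algebraMap A L ω} = ⊤ := by
    refine Algebra.adjoin_eq_top_of_isFractionRing (R := A) hωL fun a ↦ ?_
    exact Algebra.mem_adjoin_of_isScalarTower K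
      (Algebra.algebraMap_mem_adjoin_singleton (htop ▸ trivial : a ∈ Algebra.adjoin S {ω}))
  have : FiniteDimensional K L := (PowerBasis.ofAdjoinEqTop hωL htop').finite
  have : IsIntegralClosure (integralClosure A L) S L := by
    refine ⟨Subtype.val_injective, fun {x} ↦ ⟨fun hx ↦ ⟨⟨x, hx.tower_top⟩, rfl⟩, ?_⟩⟩
    rintro ⟨y, rfl⟩
    exact isIntegral_trans (R := S) (A := A) _ y.2
  exact IsIntegralClosure.finite S K L (integralClosure A L)

lemma integralClosure.finite_fractionRing [IsDomain S] [IsDomain A] [FaithfulSMul S A]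
    [IsNoetherianRing S] [IsIntegrallyClosed S] [CharZero (FractionRing S)] {ω : A}
    (hω : IsIntegral S ω) (htop : Algebra.adjoin S {ω} = ⊤) :
    Module.Finite S (integralClosure A (FractionRing A)) := by
  let : Algebra (FractionRing S) (FractionRing A) := FractionRing.liftAlgebra S (FractionRing A)
  exact integralClosure.finite_of_adjoin_eq_top (FractionRing S) (FractionRing A) hω htop

/-- The normalization of `S[ω]` is generated by `ω` up to denominators in `S`. -/
lemma integralClosure.exists_smul_mem_adjoin [IsDomain S] [IsDomain A] [FaithfulSMul S A]
    [Algebra.IsIntegral S A] {ω : A} (htop : Algebra.adjoin S {ω} = ⊤)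
    (r : integralClosure A (FractionRing A)) :
    ∃ s : S, s ≠ 0 ∧ s • r ∈
      Algebra.adjoin S {algebraMap A (integralClosure A (FractionRing A)) ω} := by
  obtain ⟨a, b, hb, hab⟩ := IsFractionRing.div_surjective (A := A) (r : FractionRing A)
  obtain ⟨s, hs, c, hc⟩ :=
    (Algebra.IsIntegral.isIntegral (R := S) b).isAlgebraic.exists_nonzero_dvd hb
  refine ⟨s, hs, ?_⟩
  have h1 : s • r = algebraMap A (integralClosure A (FractionRing A)) (a * c) := by
    refine Subtype.val_injective ?_
    change s • (r : FractionRing A) = algebraMap A (FractionRing A) (a * c)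
    have hb0 : algebraMap A (FractionRing A) b ≠ 0 := by
      simpa using nonZeroDivisors.ne_zero hb
    rw [← hab, Algebra.smul_def, IsScalarTower.algebraMap_apply S A (FractionRing A), hc, map_mul,
      map_mul]
    field_simp
  rw [h1]
  exact Algebra.algebraMap_mem_adjoin_singleton (htop ▸ trivial : a * c ∈ Algebra.adjoin S {ω})

end Normalization

/-- If `R` is generated by `ω` over `S` up to denominators in `S`, then `ω` generates the fraction
field of `R`, and of its localizations, over the fraction field of `S`. -/
lemma Algebra.adjoin_eq_top_of_smul_mem_adjoin {S R K L : Type*} [CommRing S] [CommRing R]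
    [Algebra S R] [Algebra.IsIntegral S R] [Field K] [Field L] [Algebra S K] [FaithfulSMul S K]
    [Algebra R L] [Algebra S L] [Algebra K L] [IsScalarTower S K L] [IsScalarTower S R L]
    [IsFractionRing R L] {ω : R} (hgen : ∀ r : R, ∃ s : S, s ≠ 0 ∧ s • r ∈ Algebra.adjoin S {ω}) :
    Algebra.adjoin K {algebraMap R L ω} = ⊤ := by
  refine Algebra.adjoin_eq_top_of_isFractionRing (R := R)
    ((Algebra.IsIntegral.isIntegral (R := S) ω).algebraMap (B := L)).tower_top fun r ↦ ?_
  obtain ⟨s, hs, hsr⟩ := hgen r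
  have h1 : algebraMap R L (s • r) ∈ Algebra.adjoin K {algebraMap R L ω} := by
    exact Algebra.mem_adjoin_of_isScalarTower K (Algebra.algebraMap_mem_adjoin_singleton hsr)
  have hs0 : algebraMap S K s ≠ 0 :=
    (map_ne_zero_iff _ (FaithfulSMul.algebraMap_injective S K)).mpr hs
  have h3 := Subalgebra.smul_mem _ h1 (algebraMap S K s)⁻¹
  rwa [Algebra.smul_def s, map_mul, ← IsScalarTower.algebraMap_apply,
    IsScalarTower.algebraMap_apply S K L, ← Algebra.smul_def, inv_smul_smul₀ hs0] at h3

/-- Generation by `ω` up to denominators passes to localizations. -/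
lemma IsLocalization.exists_smul_mem_adjoin {S R V W : Type*} [CommRing S] [IsDomain S] [CommRing R]
    [CommRing V] [CommRing W] [Algebra S R] [Algebra S V] [Algebra R W] [Algebra V W]
    [Algebra S W] [IsScalarTower S R W] [IsScalarTower S V W] [FaithfulSMul S V]
    (M : Submonoid S) (hM : M ≤ nonZeroDivisors S)
    [IsLocalization (Algebra.algebraMapSubmonoid R M) W] {ω : R}
    (hgen : ∀ r : R, ∃ s : S, s ≠ 0 ∧ s • r ∈ Algebra.adjoin S {ω}) (w : W) :
    ∃ v : V, v ≠ 0 ∧ v • w ∈ Algebra.adjoin V {algebraMap R W ω} := by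
  obtain ⟨⟨r, _, m, hm, rfl⟩, hr⟩ :=
    IsLocalization.surj (Algebra.algebraMapSubmonoid R M) w
  simp only at hr
  obtain ⟨s, hs, hsr⟩ := hgen r
  refine ⟨algebraMap S V (s * m), ?_, ?_⟩
  · refine (map_ne_zero_iff _ (FaithfulSMul.algebraMap_injective S V)).mpr ?_
    exact mul_ne_zero hs (nonZeroDivisors.ne_zero (hM hm))
  · have h1 : algebraMap S V (s * m) • w = algebraMap R W (s • r) := by
      rw [Algebra.smul_def, ← IsScalarTower.algebraMap_apply, Algebra.smul_def, map_mul, map_mul,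
        ← hr, IsScalarTower.algebraMap_apply S R W, IsScalarTower.algebraMap_apply S R W]
      ring
    rw [h1]
    exact Algebra.mem_adjoin_of_isScalarTower V (Algebra.algebraMap_mem_adjoin_singleton hsr)

/-! ### Étale and tamely ramified normal extensions -/

lemma Algebra.Etale.of_pow_eq_pow_mul_of_smul_mem_adjoin {V W : Type*} [CommRing V]
    [IsDomain V] [IsIntegrallyClosed V] [CommRing W] [IsDomain W] [IsIntegrallyClosed W]
    [Algebra V W] [Algebra.IsIntegral V W] [FaithfulSMul V W] [CharZero V] {p : ℕ} (hp : p.Prime)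
    {k g l y : V} (u : Vˣ) (hk0 : k ≠ 0) (hl0 : l ≠ 0) (hg : IsUnit g)
    (hu : (p : V) = u * l ^ (p - 1)) (hy : l ^ p ∣ g - y ^ p) {ω : W}
    (hω : ω ^ p = algebraMap V W (k ^ p * g))
    (hgen : ∀ w : W, ∃ v : V, v ≠ 0 ∧ v • w ∈ Algebra.adjoin V {ω}) : Algebra.Etale V W := by
  let : Algebra (FractionRing V) (FractionRing W) := FractionRing.liftAlgebra V (FractionRing W)
  have : CharZero (FractionRing V) :=
    charZero_of_injective_algebraMap (IsFractionRing.injective V (FractionRing V))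
  exact .of_pow_eq_pow_mul (FractionRing V) (FractionRing W) hp u hk0 hl0 hg hu hy hω
    (Algebra.adjoin_eq_top_of_smul_mem_adjoin hgen)

/-- At a prime `P` of height one containing `p`, the localization of `R` is obtained from `S_P` by
adjoining a `p`-th root of `h ^ p * g` with `g` as in the criterion. -/
theorem ReducedPowerOrdCriterion.isPUnramified {p : ℕ} (hp : p.Prime) {S R : Type*} [CommRing S]
    [IsDomain S] [IsNoetherianRing S] [IsIntegrallyClosed S] [CharZero S] [CommRing R] [IsDomain R]
    [IsIntegrallyClosed R] [Algebra S R] [FaithfulSMul S R] [Algebra.IsIntegral S R]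
    {ε : S} (hε : IsPrimitiveRoot ε p) {f : S} (hf : f ≠ 0) {ω : R}
    (hω : ω ^ p = algebraMap S R f)
    (hgen : ∀ r : R, ∃ s : S, s ≠ 0 ∧ s • r ∈ Algebra.adjoin S {ω})
    (h : ReducedPowerOrdCriterion p f) : IsPUnramified p S R := by
  intro P _ hP1 hpP
  have hp0 : (p : S) ≠ 0 := Nat.cast_ne_zero.mpr hp.ne_zero
  have hPass := (mem_associatedPrimes_iff_height_eq_one hp0 P).mpr ⟨hP1, hpP⟩
  have hdvr := IsDiscreteValuationRing.localization_of_height_eq_one P hP1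
  obtain ⟨k, g, hkg, hg, hbound⟩ := h P hPass
  let V := Localization.AtPrime P
  let M := Algebra.algebraMapSubmonoid R P.primeCompl
  let W := Localization M
  have hM : M ≤ nonZeroDivisors R := by
    rintro _ ⟨s, hs, rfl⟩
    refine mem_nonZeroDivisors_of_ne_zero ?_
    refine (map_ne_zero_iff _ (FaithfulSMul.algebraMap_injective S R)).mpr ?_
    rintro rfl
    exact hs (zero_mem P)
  have : IsDomain W := IsLocalization.isDomain_localization hM
  have : IsIntegrallyClosed W := isIntegrallyClosed_of_isLocalization W M hM
  have hinjP : Function.Injective (algebraMap S V) :=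
    IsLocalization.injective _ P.primeCompl_le_nonZeroDivisors
  have hinjSW : Function.Injective (algebraMap S W) := by
    rw [IsScalarTower.algebraMap_eq S R W]
    exact (IsLocalization.injective _ hM).comp (FaithfulSMul.algebraMap_injective S R)
  have : FaithfulSMul V W := by
    rw [faithfulSMul_iff_algebraMap_injective, injective_iff_map_eq_zero]
    intro x hx
    obtain ⟨⟨a, s⟩, hs⟩ := IsLocalization.surj P.primeCompl x
    have h1 : algebraMap S W a = 0 := by
      rw [IsScalarTower.algebraMap_apply S V W, ← hs, map_mul, hx, zero_mul]
    rw [(map_eq_zero_iff _ hinjSW).mp h1, map_zero] at hs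
    refine (mul_eq_zero.mp hs).resolve_right ((map_ne_zero_iff _ hinjP).mpr ?_)
    exact fun h ↦ s.2 (h ▸ zero_mem P)
  have : FaithfulSMul S V := (faithfulSMul_iff_algebraMap_injective _ _).mpr hinjP
  have : Algebra.IsIntegral V W := ⟨isIntegral_localization (R := S) (S := R) (M := P.primeCompl)⟩
  have : CharZero V := charZero_of_injective_algebraMap hinjP
  have hp0' : (p : V) ≠ 0 := Nat.cast_ne_zero.mpr hp.ne_zero
  have hεP : IsPrimitiveRoot (algebraMap S V ε) p := hε.map_of_injective hinjP
  obtain ⟨y, hy⟩ := (powerOrdBound_iff P hp hp0' hεP g).mp hbound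
  obtain ⟨u, hu⟩ := (hεP.associated_natCast_sub_one_pow hp).symm
  have hl0 : algebraMap S V ε - 1 ≠ 0 := fun h ↦ hp0' (by
    rw [← hu, h, zero_pow (by have := hp.two_le; lia), zero_mul])
  have hk0 : k ≠ 0 := by
    rintro rfl
    rw [zero_pow hp.ne_zero, zero_mul] at hkg
    exact hf ((map_eq_zero_iff _ hinjP).mp hkg)
  refine Algebra.Etale.of_pow_eq_pow_mul_of_smul_mem_adjoin (V := V) (W := W) hp u hk0 hl0 hg
    (by rw [← hu, mul_comm]) hy (ω := algebraMap R W ω) ?_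
    (IsLocalization.exists_smul_mem_adjoin P.primeCompl P.primeCompl_le_nonZeroDivisors hgen)
  rw [← map_pow, hω, ← hkg, ← IsScalarTower.algebraMap_apply, ← IsScalarTower.algebraMap_apply]

lemma IsTamelyRamified.of_formallyUnramified {V W : Type*} [CommRing V] [IsDomain V]
    [IsDiscreteValuationRing V] [CommRing W] [IsDomain W] [IsDiscreteValuationRing W] [Algebra V W]
    [IsLocalHom (algebraMap V W)] [Algebra.EssFiniteType V W] [Algebra.FormallyUnramified V W] :
    IsTamelyRamified (algebraMap V W) := by
  refine ⟨?_, ?_⟩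
  · have e : (IsLocalRing.ResidueField.map (algebraMap V W)).toAlgebra =
        IsLocalRing.ResidueField.instAlgebra := by
      refine Algebra.algebra_ext _ _ fun x ↦ ?_
      obtain ⟨x, rfl⟩ := IsLocalRing.residue_surjective x
      rfl
    rw [e]
    infer_instance
  · obtain ⟨π, hπ⟩ := IsDiscreteValuationRing.exists_irreducible V
    refine ⟨π, hπ, 1, ?_, Nat.coprime_one_left _⟩
    have hmax := Algebra.FormallyUnramified.map_maximalIdeal (R := V) (S := W)
    rw [hπ.maximalIdeal_eq, Ideal.map_span, Set.image_singleton] at hmax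
    have hirr := (IsDiscreteValuationRing.irreducible_iff_uniformizer _).mpr hmax.symm
    rw [idealOrd_maximalIdeal_eq_addVal, Nat.cast_one]
    exact IsDiscreteValuationRing.addVal_uniformizer hirr

/-- Étale extensions are tamely ramified: the extensions of discrete valuation rings have separable
residue field extensions and ramification index one. -/
theorem IsPUnramified.isTamelyPRamified {p : ℕ} {S R : Type*} [CommRing S] [IsDomain S]
    [IsNoetherianRing S] [IsIntegrallyClosed S] [CommRing R] [IsDomain R] [IsIntegrallyClosed R]
    [Algebra S R] [FaithfulSMul S R] [Module.Finite S R] (h : IsPUnramified p S R) :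
    IsTamelyPRamified p S R := by
  intro Q _ hQ hpQ
  have : IsNoetherianRing R := IsNoetherianRing.of_finite S R
  set P := Q.comap (algebraMap S R) with hP
  have hP1 : P.height = 1 := Ideal.height_comap_eq_one hQ
  have hpP : (p : S) ∈ P := by rw [hP, Ideal.mem_comap, map_natCast]; exact hpQ
  have hV := IsDiscreteValuationRing.localization_of_height_eq_one P hP1
  have hVQ := IsDiscreteValuationRing.localization_of_height_eq_one Q hQ
  have hetale := h P hP1 hpP
  let W := Localization (Algebra.algebraMapSubmonoid R P.primeCompl)
  have hle : Algebra.algebraMapSubmonoid R P.primeCompl ≤ Q.primeCompl := by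
    rintro _ ⟨s, hs, rfl⟩
    exact hs
  let : Algebra W (Localization.AtPrime Q) :=
    IsLocalization.localizationAlgebraOfSubmonoidLe W (Localization.AtPrime Q) _ _ hle
  have : IsScalarTower R W (Localization.AtPrime Q) :=
    IsLocalization.localization_isScalarTower_of_submonoid_le W (Localization.AtPrime Q) _ _ hle
  have : IsScalarTower S W (Localization.AtPrime Q) := .to₁₃₄ S R W (Localization.AtPrime Q)
  have hunr : Algebra.FormallyUnramified S (Localization.AtPrime Q) := by
    have h1 : Algebra.FormallyUnramified S (Localization.AtPrime P) :=
      .of_isLocalization P.primeCompl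
    have h2 : Algebra.FormallyUnramified S W := .comp S (Localization.AtPrime P) W
    have h3 := IsLocalization.isLocalization_of_submonoid_le W (Localization.AtPrime Q) _ _ hle
    have h4 : Algebra.FormallyUnramified W (Localization.AtPrime Q) :=
      .of_isLocalization (Q.primeCompl.map (algebraMap R W))
    exact .comp S W _
  let φ := Localization.localRingHom P Q (algebraMap S R) rfl
  let : Algebra (Localization.AtPrime P) (Localization.AtPrime Q) := φ.toAlgebra
  have : IsLocalHom (algebraMap (Localization.AtPrime P) (Localization.AtPrime Q)) :=
    inferInstanceAs (IsLocalHom φ)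
  have : IsScalarTower S (Localization.AtPrime P) (Localization.AtPrime Q) := by
    refine .of_algebraMap_eq fun s ↦ ?_
    change _ = φ _
    rw [Localization.localRingHom_to_map, IsScalarTower.algebraMap_apply S R]
  have : Algebra.FormallyUnramified (Localization.AtPrime P) (Localization.AtPrime Q) :=
    .of_restrictScalars S _ _
  have : Algebra.EssFiniteType (Localization.AtPrime P) (Localization.AtPrime Q) :=
    .of_comp S _ _
  exact IsTamelyRamified.of_formallyUnramified (V := Localization.AtPrime P)
    (W := Localization.AtPrime Q)

/-- Above every height one prime of `S` containing `p` lies some height one prime of `R`, and tame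
ramification at that single prime is enough. -/
theorem IsTamelyPRamified.reducedPowerOrdCriterion {p : ℕ} (hp : p.Prime) {S R : Type*}
    [CommRing S] [IsDomain S] [IsNoetherianRing S] [IsIntegrallyClosed S] [CommRing R] [IsDomain R]
    [IsIntegrallyClosed R] [Algebra S R] [FaithfulSMul S R] [Module.Finite S R]
    (hp0 : (p : S) ≠ 0) {ε : S} (hε : IsPrimitiveRoot ε p) {f : S} (hf : f ≠ 0) {ω : R}
    (hω : ω ^ p = algebraMap S R f) (h : IsTamelyPRamified p S R) :
    ReducedPowerOrdCriterion p f := by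
  intro P _ hP
  have : IsNoetherianRing R := IsNoetherianRing.of_finite S R
  obtain ⟨hP1, hpP⟩ := (mem_associatedPrimes_iff_height_eq_one hp0 P).mp hP
  obtain ⟨⟨Q, hQ, hQP⟩⟩ := Ideal.nonempty_primesOver (S := R) P
  obtain rfl : P = Q.comap (algebraMap S R) := hQP.over
  have hQ1 : Q.height = 1 := Ideal.height_eq_one_of_comap hP1
  have hpQ : (p : R) ∈ Q := by simpa using hpP
  set P := Q.comap (algebraMap S R)
  have hV := IsDiscreteValuationRing.localization_of_height_eq_one P hP1
  have hVQ := IsDiscreteValuationRing.localization_of_height_eq_one Q hQ1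
  let φ := Localization.localRingHom P Q (algebraMap S R) rfl
  have hinjP : Function.Injective (algebraMap S (Localization.AtPrime P)) :=
    IsLocalization.injective _ P.primeCompl_le_nonZeroDivisors
  have hinjQ : Function.Injective (algebraMap R (Localization.AtPrime Q)) :=
    IsLocalization.injective _ Q.primeCompl_le_nonZeroDivisors
  have hφ : Function.Injective φ := by
    rw [injective_iff_map_eq_zero]
    intro x hx
    obtain ⟨a, s, rfl⟩ := IsLocalization.exists_mk'_eq P.primeCompl x
    rw [Localization.localRingHom_mk', IsLocalization.mk'_eq_zero_iff] at hx
    obtain ⟨⟨t, ht⟩, hta⟩ := hx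
    have ht0 : t ≠ 0 := fun h ↦ ht (h ▸ zero_mem Q)
    have ha : algebraMap S R a = 0 := (mul_eq_zero.mp hta).resolve_left ht0
    rw [(map_eq_zero_iff _ (FaithfulSMul.algebraMap_injective S R)).mp ha, IsLocalization.mk'_zero]
  have hp0' : (p : Localization.AtPrime P) ≠ 0 := by
    rw [← map_natCast (algebraMap S (Localization.AtPrime P))]
    exact (map_ne_zero_iff _ hinjP).mpr hp0
  have hpm : (p : Localization.AtPrime P) ∈
      IsLocalRing.maximalIdeal (Localization.AtPrime P) := by
    rw [← map_natCast (algebraMap S (Localization.AtPrime P))]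
    exact (IsLocalization.AtPrime.to_map_mem_maximal_iff _ P _).mpr hpP
  have hεP := hε.map_of_injective hinjP
  obtain ⟨k, g, hkg, hg, hy⟩ :=
    IsTamelyRamified.exists_eq_pow_mul φ hφ (h Q hQ1 hpQ) hp hp0' hpm hεP
    (f := algebraMap S _ f) ((map_ne_zero_iff _ hinjP).mpr hf) (ω := algebraMap R _ ω) (by
      rw [← map_pow, hω, Localization.localRingHom_to_map])
  exact ⟨k, g, hkg, hg, (powerOrdBound_iff P hp hp0' hεP g).mpr hy⟩

/-! ### The normalization of `S[ω]` -/

section Monogenic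

variable {S A : Type*} [CommRing S] [IsDomain S] [IsNoetherianRing S] [IsIntegrallyClosed S]
  [CharZero (FractionRing S)] [CommRing A] [IsDomain A] [Algebra S A] [FaithfulSMul S A]
  {p : ℕ} {f : S} {ω : A}

lemma IsPUnramified.isTamelyPRamified_integralClosure (hp : p.Prime)
    (htop : Algebra.adjoin S {ω} = ⊤) (hω : ω ^ p = algebraMap S A f)
    (h : IsPUnramified p S (integralClosure A (FractionRing A))) :
    IsTamelyPRamified p S (integralClosure A (FractionRing A)) := by
  have := integralClosure.isIntegrallyClosed_fractionRing (A := A)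
  have := integralClosure.faithfulSMul_fractionRing (S := S) (A := A)
  have := integralClosure.finite_fractionRing (.of_pow_eq_algebraMap hp.pos hω) htop
  exact h.isTamelyPRamified

lemma IsTamelyPRamified.reducedPowerOrdCriterion_of_integralClosure (hp : p.Prime)
    (htop : Algebra.adjoin S {ω} = ⊤) (hω : ω ^ p = algebraMap S A f) {ε : S}
    (hε : IsPrimitiveRoot ε p) (hf : f ≠ 0)
    (h : IsTamelyPRamified p S (integralClosure A (FractionRing A))) :
    ReducedPowerOrdCriterion p f := by
  have := integralClosure.isIntegrallyClosed_fractionRing (A := A)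
  have := integralClosure.faithfulSMul_fractionRing (S := S) (A := A)
  have := integralClosure.finite_fractionRing (.of_pow_eq_algebraMap hp.pos hω) htop
  have : CharZero S :=
    ((algebraMap S (FractionRing S)).charZero_iff (IsFractionRing.injective _ _)).mpr ‹_›
  refine h.reducedPowerOrdCriterion hp (Nat.cast_ne_zero.mpr hp.ne_zero) hε hf
    (ω := algebraMap A _ ω) ?_
  rw [← map_pow, hω, ← IsScalarTower.algebraMap_apply]

lemma ReducedPowerOrdCriterion.isPUnramified_integralClosure (hp : p.Prime)
    (htop : Algebra.adjoin S {ω} = ⊤) (hω : ω ^ p = algebraMap S A f) {ε : S}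
    (hε : IsPrimitiveRoot ε p) (hf : f ≠ 0) (h : ReducedPowerOrdCriterion p f) :
    IsPUnramified p S (integralClosure A (FractionRing A)) := by
  have := integralClosure.isIntegrallyClosed_fractionRing (A := A)
  have := integralClosure.faithfulSMul_fractionRing (S := S) (A := A)
  have := Algebra.isIntegral_of_adjoin_eq_top (.of_pow_eq_algebraMap hp.pos hω) htop
  have := integralClosure.isIntegral_fractionRing (S := S) (A := A)
  have : CharZero S :=
    ((algebraMap S (FractionRing S)).charZero_iff (IsFractionRing.injective _ _)).mpr ‹_›
  refine h.isPUnramified hp hε hf (ω := algebraMap A _ ω) ?_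
    (integralClosure.exists_smul_mem_adjoin htop)
  rw [← map_pow, hω, ← IsScalarTower.algebraMap_apply]

end Monogenic

lemma Algebra.adjoin_singleton_mk_eq_top {S L : Type*} [CommRing S] [CommRing L] [Algebra S L]
    (ω : L) : Algebra.adjoin S
      {(⟨ω, Algebra.self_mem_adjoin_singleton S ω⟩ : Algebra.adjoin S {ω})} = ⊤ := by
  have h := Algebra.adjoin_adjoin_coe_preimage (R := S) (s := {ω})
  convert h using 2
  ext x
  simp [Subtype.ext_iff]

/-! ### The criterion for `f` itself -/

section Criterion

variable {S : Type*} [CommRing S] [IsDomain S] [IsNoetherianRing S] [IsIntegrallyClosed S]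
  [CharZero S] {p : ℕ} {ε f : S}

lemma PowerOrdCriterion.reducedPowerOrdCriterion (hp : p.Prime) (hε : IsPrimitiveRoot ε p)
    (h : PowerOrdCriterion p f) : ReducedPowerOrdCriterion p f := by
  intro Q _ hQ
  obtain ⟨k, rfl⟩ | ⟨hfQ, hb⟩ := h
  · have hp0 : (p : S) ≠ 0 := Nat.cast_ne_zero.mpr hp.ne_zero
    have := IsDiscreteValuationRing.localization_of_mem_associatedPrimes hp0 Q hQ
    have hinj : Function.Injective (algebraMap S (Localization.AtPrime Q)) :=
      IsLocalization.injective _ Q.primeCompl_le_nonZeroDivisors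
    have : CharZero (Localization.AtPrime Q) := charZero_of_injective_algebraMap hinj
    refine ⟨algebraMap S _ k, 1, by rw [map_pow, mul_one], isUnit_one, ?_⟩
    rw [powerOrdBound_iff Q hp (Nat.cast_ne_zero.mpr hp.ne_zero) (hε.map_of_injective hinj)]
    exact ⟨1, by simp⟩
  · exact ⟨1, algebraMap S _ f, by rw [one_pow, one_mul],
      IsLocalization.map_units _ (⟨f, hfQ Q hQ⟩ : Q.primeCompl), hb Q hQ⟩

/-- If `ord_Q(f) < p`, then the factor `h` of a decomposition `f = h ^ p * g` with `g` a unit is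
itself a unit, and can be absorbed into the `p`-th power which approximates `g`. -/
lemma ReducedPowerOrdCriterion.powerOrdCriterion (hp : p.Prime) (hε : IsPrimitiveRoot ε p)
    (hord : ∀ (Q : Ideal S) [Q.IsPrime], Q ∈ associatedPrimes S (S ⧸ Ideal.span {(p : S)}) →
      primeOrd Q f < (p : ℕ∞))
    (h : ReducedPowerOrdCriterion p f) : PowerOrdCriterion p f := by
  have key : ∀ (Q : Ideal S) [Q.IsPrime], Q ∈ associatedPrimes S (S ⧸ Ideal.span {(p : S)}) →
      f ∉ Q ∧ PowerOrdBound p Q (algebraMap S (Localization.AtPrime Q) f) := by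
    intro Q _ hQ
    have hp0 : (p : S) ≠ 0 := Nat.cast_ne_zero.mpr hp.ne_zero
    have := IsDiscreteValuationRing.localization_of_mem_associatedPrimes hp0 Q hQ
    have hinj : Function.Injective (algebraMap S (Localization.AtPrime Q)) :=
      IsLocalization.injective _ Q.primeCompl_le_nonZeroDivisors
    have : CharZero (Localization.AtPrime Q) := charZero_of_injective_algebraMap hinj
    have hiff := powerOrdBound_iff Q hp (Nat.cast_ne_zero.mpr hp.ne_zero)
      (hε.map_of_injective hinj)
    obtain ⟨k, g, hkg, hg, hb⟩ := h Q hQ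
    have hk : IsUnit k := by
      by_contra hk
      have hlt := hord Q hQ
      rw [primeOrd, ← not_le, natCast_le_idealOrd_iff] at hlt
      refine hlt ?_
      rw [hkg]
      exact Ideal.mul_mem_right _ _ (Ideal.pow_mem_pow ((IsLocalRing.mem_maximalIdeal k).mpr hk) p)
    refine ⟨?_, ?_⟩
    · rw [← IsLocalization.AtPrime.to_map_mem_maximal_iff (Localization.AtPrime Q) Q f,
        IsLocalRing.mem_maximalIdeal, mem_nonunits_iff, not_not, hkg]
      exact (hk.pow p).mul hg
    · obtain ⟨y, hy⟩ := (hiff g).mp hb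
      rw [hiff, hkg]
      refine ⟨k * y, ?_⟩
      rw [mul_pow, ← mul_sub]
      exact hy.mul_left _
  refine .inr ⟨fun Q hQ ↦ ?_, fun Q _ hQ ↦ (key Q hQ).2⟩
  have := IsAssociatedPrime.isPrime hQ
  exact (key Q hQ).1

end Criterion

theorem theorem4p1 {S : Type*} [CommRing S] [IsDomain S] [IsRegularLocalRing S]
    [CharZero (FractionRing S)] (p : ℕ) (hp : p.Prime) (ε : S) (hε : IsPrimitiveRoot ε p)
    (f : S) (hf : f ≠ 0) :
    List.TFAE [IsPUnramifiedElement p f, IsTamelyPRamifiedElement p f,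
      ReducedPowerOrdCriterion p f] ∧
    (PowerOrdCriterion p f → IsPUnramifiedElement p f) ∧
    ((∀ (Q : Ideal S) [Q.IsPrime], Q ∈ associatedPrimes S (S ⧸ Ideal.span {(p : S)}) →
        primeOrd Q f < (p : ℕ∞)) →
      List.TFAE [IsPUnramifiedElement p f, IsTamelyPRamifiedElement p f,
        PowerOrdCriterion p f]) := by
  have := (IsRegularLocalRing.isDomain_and_isIntegrallyClosed S).2
  have : CharZero S :=
    ((algebraMap S (FractionRing S)).charZero_iff (IsFractionRing.injective _ _)).mpr ‹_›
  have hinj : Function.Injective (algebraMap S (AlgebraicClosure (FractionRing S))) := by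
    rw [IsScalarTower.algebraMap_eq S (FractionRing S)]
    exact (algebraMap (FractionRing S) _).injective.comp (IsFractionRing.injective S _)
  have (ω : AlgebraicClosure (FractionRing S)) : FaithfulSMul S (Algebra.adjoin S {ω}) :=
    (faithfulSMul_iff_algebraMap_injective _ _).mpr fun a b hab ↦
      hinj (congrArg Subtype.val hab)
  have hpow (ω : AlgebraicClosure (FractionRing S)) (hω : ω ^ p = algebraMap S _ f) :
      (⟨ω, Algebra.self_mem_adjoin_singleton S ω⟩ : Algebra.adjoin S {ω}) ^ p =
        algebraMap S _ f := Subtype.ext hω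
  have h12 : IsPUnramifiedElement p f → IsTamelyPRamifiedElement p f := fun ⟨ω, hω, h⟩ ↦
    ⟨ω, hω, h.isTamelyPRamified_integralClosure hp (Algebra.adjoin_singleton_mk_eq_top ω)
      (hpow ω hω)⟩
  have h24 : IsTamelyPRamifiedElement p f → ReducedPowerOrdCriterion p f := fun ⟨ω, hω, h⟩ ↦
    h.reducedPowerOrdCriterion_of_integralClosure hp (Algebra.adjoin_singleton_mk_eq_top ω)
      (hpow ω hω) hε hf
  have h41 : ReducedPowerOrdCriterion p f → IsPUnramifiedElement p f := fun h ↦ by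
    obtain ⟨ω, hω⟩ := IsAlgClosed.exists_pow_nat_eq
      (algebraMap S (AlgebraicClosure (FractionRing S)) f) hp.pos
    exact ⟨ω, hω, h.isPUnramified_integralClosure hp (Algebra.adjoin_singleton_mk_eq_top ω)
      (hpow ω hω) hε hf⟩
  have h34 : PowerOrdCriterion p f → ReducedPowerOrdCriterion p f :=
    fun h ↦ h.reducedPowerOrdCriterion hp hε
  refine ⟨?_, fun h ↦ h41 (h34 h), fun hord ↦ ?_⟩
  · tfae_have 1 → 2 := h12
    tfae_have 2 → 3 := h24
    tfae_have 3 → 1 := h41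
    tfae_finish
  · tfae_have 1 → 2 := h12
    tfae_have 2 → 3 := fun h ↦ (h24 h).powerOrdCriterion hp hε hord
    tfae_have 3 → 1 := fun h ↦ h41 (h34 h)
    tfae_finish
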